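/- Let $\Lambda=\langle A,R\rangle$ be a finite abstract argumentation framework (AF), $g\in A$ a goal argument, $\sigma\in\{\mathtt{co},\mathtt{st},\mathtt{pr},\mathtt{sst}\}$ the complete, stable, preferred or semi-stable semantics, $\mathcal L\in\sigma(\Lambda)$ a $\sigma$-labelling of $\Lambda$ with labels $\mathbf{in},\mathbf{out},\mathbf{und}$, and $T\in\{CF,SF\}$. Write $\delta(\mathcal L,\mathcal L')$ for the number of arguments on which $\mathcal L$ and $\mathcal L'$ differ, and $\ell(\mathcal L,a)$ for the atom $\mathbf{in}(a)$, $\mathbf{out}(a)$ or $\mathbf{und}(a)$ that gives the label of $a$ in $\mathcal L$. The counterfactuals $\mathcal{CF}^\sigma(g,\mathcal L)$ are the $\mathcal L'\in\sigma(\Lambda)$ with $\mathcal L'(g)\ne\mathcal L(g)$ that have minimum $\delta(\mathcal L,\mathcal L')$ among all such labellings; the semifactuals $\mathcal{SF}^\sigma(g,\mathcal L)$ are the $\mathcal L'\in\sigma(\Lambda)$ with $\mathcal L'(g)=\mathcal L(g)$ that have maximum $\delta(\mathcal L,\mathcal L')$ among all such labellings. Let $P_\Lambda=\{\mathbf{arg}(a)\mid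 a\in A\}\cup\{\mathbf{att}(a,b)\mid(a,b)\in R\}$. An answer set represents a labelling $\mathcal L'$ if its atoms $\mathbf{in}(a),\mathbf{out}(a),\mathbf{und}(a)$ with $a\in A$ are exactly the atoms $\ell(\mathcal L',a)$. A set $P_\sigma$ of ASP rules (disjunctive rules with default negation and conditional literals in bodies) is an encoding of $\sigma$ (on $\Lambda$) if the predicate $\mathbf w$ does not occur in it, every answer set of $P_\sigma\cup P_\Lambda$ represents a $\sigma$-labelling of $\Lambda$, and every $\sigma$-labelling of $\Lambda$ is represented by an answer set of $P_\sigma\cup P_\Lambda$. Algorithm Explain, on input $(\Lambda,g,\sigma,\mathcal L,T)$, returns the optimal answer sets of the asprin program $P_\Lambda\cup P_\sigma\cup P_S\cup P_W$, where $P_\sigma$ is an encoding of $\sigma$; for $T=CF$, $P_S=\{\text{:- }\ell(\mathcal L,g)\}$ and $P_W=\{\mathbf w(a)\text{ :- }\mathbf{not}\ \ell(\mathcal L,a)\mid a\in A\setminus\{g\}\}$; for $T=SF$, $P_S=\{\text{:- }\mathbf{not}\ \ell(\mathcal L,g)\}$ and $P_W=\{\mathbf w(a)\text{ :- }\ell(\mathcal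 L,a)\mid a\in A\setminus\{g\}\}$. Here an answer set is optimal if no other answer set satisfies strictly fewer of the preference elements $\{\mathbf w(X):\mathbf{arg}(X)\}$ (preference type less(cardinality)). Then Explain is sound and complete, for every encoding $P_\sigma$ of $\sigma$: every answer set that it returns represents an element of $\mathcal{CF}^\sigma(g,\mathcal L)$ if $T=CF$, and of $\mathcal{SF}^\sigma(g,\mathcal L)$ if $T=SF$; and every element of that set is represented by some returned answer set. Moreover, for each $\sigma$ there is an explicit set of rules, without constants and independent of $\Lambda$, that is an encoding of $\sigma$ on every finite AF; for $\sigma=\mathtt{st}$ it is \[\begin{array}{l}\mathbf{in}(X)\text{ :- }\mathbf{not}\ \mathbf{out}(X),\mathbf{arg}(X);\quad \mathbf{out}(X)\text{ :- }\mathbf{not}\ \mathbf{in}(X),\mathbf{arg}(X);\quad \mathbf{defeated}(X)\text{ :- }\mathbf{in}(Y),\mathbf{att}(Y,X);\\ \text{:- }\mathbf{in}(X),\mathbf{in}(Y),\mathbf{att}(X,Y);\quad \text{:- }\mathbf{out}(X),\mathbf{not}\ \mathbf{defeated}(X).\end{array}\] With these encodings every element of $\mathcal{CF}^\sigma(g,\mathcal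 L)$ (if $T=CF$), respectively $\mathcal{SF}^\sigma(g,\mathcal L)$ (if $T=SF$), is represented by exactly one returned answer set. -/

import Mathlib

namespace ArgASP

/-! ## Abstract argumentation -/

/-- An abstract argumentation framework whose set of arguments is the type `α`;
`att b a` says that `b` attacks `a`. -/
structure AF (α : Type*) where
  att : α → α → Prop

/-- The three labels of an argument. -/
inductive Label
  | inn
  | out
  | und

/-- The multiple-status semantics: complete, stable, preferred, semi-stable. -/
inductive Semantics
  | co
  | st
  | pr
  | sst

/-- The two tasks: counterfactuals and semifactuals. -/
inductive TaskType
  | CF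
  | SF

/-- A labelling is a total function from arguments to labels. -/
abbrev Labelling (α : Type*) := α → Label

namespace AF

variable {α : Type*} (Λ : AF α)

/-- The arguments defeated by `S`. -/
def defeated (S : Set α) : Set α := {a | ∃ b ∈ S, Λ.att b a}

/-- The arguments acceptable with respect to `S`. -/
def acceptable (S : Set α) : Set α := {a | ∀ b, Λ.att b a → b ∈ Λ.defeated S}

def ConflictFree (S : Set α) : Prop := S ∩ Λ.defeated S = ∅

def Admissible (S : Set α) : Prop := Λ.ConflictFree S ∧ S ⊆ Λ.acceptable S

def Complete (S : Set α) : Prop := Λ.Admissible S ∧ S = Λ.acceptable S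

/-- A preferred extension is an inclusion-maximal complete extension. -/
def Preferred (S : Set α) : Prop := Maximal Λ.Complete S

/-- A stable extension is a total preferred extension. -/
def Stable (S : Set α) : Prop := Λ.Preferred S ∧ S ∪ Λ.defeated S = Set.univ

/-- A semi-stable extension is a preferred extension whose range `S ∪ Def(S)` is
inclusion-maximal (among the ranges of preferred extensions). -/
def SemiStable (S : Set α) : Prop :=
  Λ.Preferred S ∧ ∀ S', Λ.Preferred S' →
    S ∪ Λ.defeated S ⊆ S' ∪ Λ.defeated S' → S' ∪ Λ.defeated S' ⊆ S ∪ Λ.defeated S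

/-- `Λ.Extension σ S`: the set `S` is a `σ`-extension of `Λ`. -/
def Extension : Semantics → Set α → Prop
  | .co => Λ.Complete
  | .st => Λ.Stable
  | .pr => Λ.Preferred
  | .sst => Λ.SemiStable

open Classical in
/-- The labelling `⟨E, Def(E), A \ (E ∪ Def(E))⟩` corresponding to an extension `E`. -/
noncomputable def labellingOf (E : Set α) : Labelling α := fun a =>
  if a ∈ E then .inn else if a ∈ Λ.defeated E then .out else .und

/-- The set `σ(Λ)` of `σ`-labellings of `Λ`. -/
def labellings (σ : Semantics) : Set (Labelling α) :=
  {L | ∃ E, Λ.Extension σ E ∧ L = Λ.labellingOf E}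

end AF

/-- The number of arguments on which two labellings differ. -/
noncomputable def labDist {α : Type*} (L L' : Labelling α) : ℕ := {a | L a ≠ L' a}.ncard

/-- The counterfactuals of `L` with respect to `g` under `σ`. -/
def counterfactuals {α : Type*} (Λ : AF α) (σ : Semantics) (g : α) (L : Labelling α) :
    Set (Labelling α) :=
  {L' | L' ∈ Λ.labellings σ ∧ L g ≠ L' g ∧
    ¬ ∃ L'' ∈ Λ.labellings σ, L g ≠ L'' g ∧ labDist L L'' < labDist L L'}

/-- The semifactuals of `L` with respect to `g` under `σ`. -/
def semifactuals {α : Type*} (Λ : AF α) (σ : Semantics) (g : α) (L : Labelling α) :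
    Set (Labelling α) :=
  {L' | L' ∈ Λ.labellings σ ∧ L g = L' g ∧
    ¬ ∃ L'' ∈ Λ.labellings σ, L g = L'' g ∧ labDist L L'' > labDist L L'}

/-- The specified output for a task. -/
def explanations {α : Type*} (T : TaskType) (Λ : AF α) (σ : Semantics) (g : α) (L : Labelling α) :
    Set (Labelling α) :=
  match T with
  | .CF => counterfactuals Λ σ g L
  | .SF => semifactuals Λ σ g L

/-! ## Answer set programs

Rules are disjunctive, with default negation and conditional literals in bodies. -/

/-- Predicate symbols. The label predicates are `lab inn`, `lab out`, `lab und`; the symbols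
after `w` are auxiliary, and `other n` is an unlimited supply of further ones. -/
inductive Pred
  | arg
  | att
  | lab (l : Label)
  | w
  | defeated
  | nin
  | undefended
  | wit
  | nwit
  | nrange
  | spoil
  | other (n : ℕ)

/-- An atom over terms of type `τ`. -/
structure Atom (τ : Type*) where
  pred : Pred
  args : List τ

/-- A term is a variable or a constant; the constants are the arguments of the AF. -/
inductive Term (α : Type*)
  | var (n : ℕ)
  | const (a : α)

/-- Value of a term under a substitution of constants for variables. -/
def Term.inst {α : Type*} (s : ℕ → α) : Term α → α
  | .var n => s n
  | .const a => a

/-- Ground instance of an atom. -/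
def Atom.inst {α : Type*} (s : ℕ → α) (A : Atom (Term α)) : Atom α :=
  ⟨A.pred, A.args.map (Term.inst s)⟩

/-- The conditional literal `lit : guard`, where the variables in `bound` are local to it:
it stands for the conjunction of `guard → lit` over all values of the local variables. -/
structure CondLit (α : Type*) where
  bound : List ℕ
  lit : Atom (Term α)
  guard : Atom (Term α)

/-- The rule `h₁ | … | hₖ :- p₁, …, pₗ, not n₁, …, not nₘ, c₁, …, cᵣ`
with atoms `hᵢ, pᵢ, nᵢ` and conditional literals `cᵢ`.
A constraint has an empty head, a fact has a one-element head and an empty body. -/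
structure Rule (α : Type*) where
  head : List (Atom (Term α)) := []
  pos : List (Atom (Term α)) := []
  neg : List (Atom (Term α)) := []
  cond : List (CondLit α) := []

abbrev Program (α : Type*) := Set (Rule α)

/-- A ground rule. A pair `(l, c)` in `cond` stands for the implication `c → l` in the body. -/
structure GroundRule (α : Type*) where
  head : Set (Atom α)
  pos : Set (Atom α)
  neg : Set (Atom α)
  cond : Set (Atom α × Atom α)

/-- Ground instance of a rule under a substitution for its (global) variables. -/
def Rule.inst {α : Type*} (s : ℕ → α) (r : Rule α) : GroundRule α where
  head := {A | ∃ B ∈ r.head, A = B.inst s}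
  pos := {A | ∃ B ∈ r.pos, A = B.inst s}
  neg := {A | ∃ B ∈ r.neg, A = B.inst s}
  cond := {p | ∃ c ∈ r.cond, ∃ t : ℕ → α, (∀ n, n ∉ c.bound → t n = s n) ∧
    p = (c.lit.inst t, c.guard.inst t)}

/-- The ground instantiation of a program. -/
def ground {α : Type*} (P : Program α) : Set (GroundRule α) :=
  {ρ | ∃ r ∈ P, ∃ s : ℕ → α, ρ = r.inst s}

/-- All implications in the set `C` hold in the interpretation `M`. -/
def CondHolds {α : Type*} (M : Set (Atom α)) (C : Set (Atom α × Atom α)) : Prop :=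
  ∀ p ∈ C, p.2 ∈ M → p.1 ∈ M

/-- The reduct with respect to `M`: rules with a negative literal or a conditional literal of
the body false in `M` are deleted, and negative literals are dropped from the others. -/
def reduct {α : Type*} (G : Set (GroundRule α)) (M : Set (Atom α)) : Set (GroundRule α) :=
  {ρ | ∃ ρ' ∈ G, (∀ A ∈ ρ'.neg, A ∉ M) ∧ CondHolds M ρ'.cond ∧ ρ = { ρ' with neg := ∅ }}

/-- `N` is a (classical) model of a set of ground rules. -/
def IsModel {α : Type*} (N : Set (Atom α)) (G : Set (GroundRule α)) : Prop :=
  ∀ ρ ∈ G, ρ.pos ⊆ N → (∀ A ∈ ρ.neg, A ∉ N) → CondHolds N ρ.cond → ∃ A ∈ ρ.head, A ∈ N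

/-- The answer sets of a program: the interpretations `M` that are
inclusion-minimal models of the reduct with respect to `M`. -/
def answerSets {α : Type*} (P : Program α) : Set (Set (Atom α)) :=
  {M | Minimal (fun N => IsModel N (reduct (ground P) M)) M}

/-! ## Preferences of type `less(cardinality)` -/

/-- A preference element `lit : guard`. -/
structure PrefElem (α : Type*) where
  lit : Atom (Term α)
  guard : Atom (Term α)

/-- The atoms of (ground instances of) the preference elements that hold in `M`. -/
def heldElems {α : Type*} (S : Set (PrefElem α)) (M : Set (Atom α)) : Set (Atom α) :=
  {A | ∃ e ∈ S, ∃ s : ℕ → α, A = e.lit.inst s ∧ e.lit.inst s ∈ M ∧ e.guard.inst s ∈ M}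

/-- The optimal answer sets of `P` under the preference statement
`#preference(p, less(cardinality)){S}` with the directive `#optimize(p)`: those to which no
answer set is preferred, where fewer satisfied preference elements are preferred. -/
def asprin {α : Type*} (P : Program α) (S : Set (PrefElem α)) : Set (Set (Atom α)) :=
  {M | M ∈ answerSets P ∧
    ¬ ∃ N ∈ answerSets P, (heldElems S N).ncard < (heldElems S M).ncard}

/-! ## The algorithm -/

section Algorithm

variable {α : Type*}

/-- The atom `ℓ(L, a)`, one of `in(a)`, `out(a)`, `und(a)`. -/
def labelAtom (L : Labelling α) (a : α) : Atom (Term α) := ⟨.lab (L a), [.const a]⟩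

/-- The set of facts describing the AF. -/
def afFacts (Λ : AF α) : Program α :=
  {r | ∃ a, r = { head := [⟨.arg, [.const a]⟩] }} ∪
  {r | ∃ a b, Λ.att a b ∧ r = { head := [⟨.att, [.const a, .const b]⟩] }}

/-- The strong constraint: `:- ℓ(L,g)` for CF and `:- not ℓ(L,g)` for SF. -/
def strongConstraint (T : TaskType) (L : Labelling α) (g : α) : Program α :=
  match T with
  | .CF => {{ pos := [labelAtom L g] }}
  | .SF => {{ neg := [labelAtom L g] }}

/-- The weak-constraint rules, for the arguments `a ≠ g`:
`w(a) :- not ℓ(L,a)` for CF and `w(a) :- ℓ(L,a)` for SF. -/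
def weakConstraints (T : TaskType) (L : Labelling α) (g : α) : Program α :=
  match T with
  | .CF => {r | ∃ a, a ≠ g ∧ r = { head := [⟨.w, [.const a]⟩], neg := [labelAtom L a] }}
  | .SF => {r | ∃ a, a ≠ g ∧ r = { head := [⟨.w, [.const a]⟩], pos := [labelAtom L a] }}

/-- The preference elements `{ w(X) : arg(X) }`. -/
def prefElems : Set (PrefElem α) := {⟨⟨.w, [.var 0]⟩, ⟨.arg, [.var 0]⟩⟩}

/-- The algorithm, run with the set of rules `P` as encoding of the semantics: it returns the
optimal answer sets of the program that it builds. -/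
def explain (Λ : AF α) (g : α) (L : Labelling α) (T : TaskType) (P : Program α) :
    Set (Set (Atom α)) :=
  asprin (afFacts Λ ∪ P ∪ strongConstraint T L g ∪ weakConstraints T L g) prefElems

/-- The answer set `M` represents the labelling `L`:
its atoms over `in`, `out`, `und` are exactly the `ℓ(L,a)`. -/
def Represents (M : Set (Atom α)) (L : Labelling α) : Prop :=
  ∀ a l, (⟨.lab l, [a]⟩ : Atom α) ∈ M ↔ L a = l

/-- The predicate symbol `p` occurs in the rule `r`. -/
def Rule.Mentions (r : Rule α) (p : Pred) : Prop :=
  (∃ A ∈ r.head, A.pred = p) ∨ (∃ A ∈ r.pos, A.pred = p) ∨ (∃ A ∈ r.neg, A.pred = p) ∨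
  (∃ c ∈ r.cond, c.lit.pred = p ∨ c.guard.pred = p)

/-- The set of rules `P` is an encoding of the semantics `σ` on the AF `Λ`: together with the
facts describing `Λ`, its answer sets represent exactly the `σ`-labellings of `Λ`
(and the predicate `w` is fresh). -/
def IsEncoding (σ : Semantics) (Λ : AF α) (P : Program α) : Prop :=
  (∀ r ∈ P, ¬ r.Mentions .w) ∧
  (∀ M ∈ answerSets (P ∪ afFacts Λ), ∃ L ∈ Λ.labellings σ, Represents M L) ∧
  (∀ L ∈ Λ.labellings σ, ∃ M ∈ answerSets (P ∪ afFacts Λ), Represents M L)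

end Algorithm

/-! ## Concrete encodings of the four semantics

They do not depend on the AF and contain no constants. -/

section Encodings

variable {α : Type*}

/-- The atom `p(X)`, where `X` is the variable number `x`. -/
def at1 (p : Pred) (x : ℕ) : Atom (Term α) := ⟨p, [.var x]⟩

/-- The atom `in(X)`. -/
def inA (x : ℕ) : Atom (Term α) := at1 (.lab .inn) x

/-- The atom `out(X)`. -/
def outA (x : ℕ) : Atom (Term α) := at1 (.lab .out) x

/-- The atom `und(X)`. -/
def undA (x : ℕ) : Atom (Term α) := at1 (.lab .und) x

/-- The atom `att(X,Y)`. -/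
def attA (x y : ℕ) : Atom (Term α) := ⟨.att, [.var x, .var y]⟩

/-- The propositional atom `spoil`. -/
def spoilA : Atom (Term α) := ⟨.spoil, []⟩

/-- The conditional literal `nwit(Z) : att(Z,Y)`, with `Z` (number 2) local. -/
def noWitAttacks (y : ℕ) : CondLit α := ⟨[2], at1 .nwit 2, attA 2 y⟩

/-- Stable semantics:
`in(X) :- not out(X), arg(X)`; `out(X) :- not in(X), arg(X)`;
`defeated(X) :- in(Y), att(Y,X)`; `:- in(X), in(Y), att(X,Y)`; `:- out(X), not defeated(X)`. -/
def encSt : Program α :=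
  { { head := [inA 0], pos := [at1 .arg 0], neg := [outA 0] },
    { head := [outA 0], pos := [at1 .arg 0], neg := [inA 0] },
    { head := [at1 .defeated 0], pos := [inA 1, attA 1 0] },
    { pos := [inA 0, inA 1, attA 0 1] },
    { pos := [outA 0], neg := [at1 .defeated 0] } }

/-- Complete semantics: guess the extension, derive the labels `out` and `und`, and check
conflict-freeness, admissibility and completeness. -/
def encCo : Program α :=
  { { head := [inA 0], pos := [at1 .arg 0], neg := [at1 .nin 0] },
    { head := [at1 .nin 0], pos := [at1 .arg 0], neg := [inA 0] },
    { head := [outA 0], pos := [inA 1, attA 1 0] },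
    { head := [undA 0], pos := [at1 .arg 0], neg := [inA 0, outA 0] },
    { head := [at1 .undefended 0], pos := [attA 1 0], neg := [outA 1] },
    { pos := [inA 0, outA 0] },
    { pos := [inA 0, at1 .undefended 0] },
    { pos := [at1 .nin 0], neg := [at1 .undefended 0] } }

/-- Guess of a second set of arguments `wit`; `spoil` is derived if `wit` is not admissible,
and then everything about `wit` is derived too (saturation). -/
def encWitness : Program α :=
  { { head := [at1 .wit 0, at1 .nwit 0], pos := [at1 .arg 0] },
    { head := [spoilA], pos := [at1 .wit 0, at1 .wit 1, attA 0 1] },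
    { head := [spoilA], pos := [at1 .wit 0, attA 1 0], cond := [noWitAttacks 1] },
    { head := [at1 .wit 0], pos := [spoilA, at1 .arg 0] },
    { head := [at1 .nwit 0], pos := [spoilA, at1 .arg 0] },
    { neg := [spoilA] } }

/-- Preferred semantics: a complete extension such that every set `wit` is spoiled, that is,
is not admissible or is not a proper superset. -/
def encPr : Program α :=
  encCo ∪ encWitness ∪
  { { head := [spoilA], pos := [inA 0, at1 .nwit 0] },
    { head := [spoilA], cond := [⟨[0], at1 .nwit 0, at1 .nin 0⟩] } }

/-- Semi-stable semantics: a complete extension such that every set `wit` is spoiled, that is,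
is not admissible or does not have a properly larger range; `nrange` holds for the arguments
outside the range of `wit`. -/
def encSst : Program α :=
  encCo ∪ encWitness ∪
  { { head := [at1 .nrange 0], pos := [at1 .nwit 0], cond := [noWitAttacks 0] },
    { head := [at1 .nrange 0], pos := [spoilA, at1 .arg 0] },
    { head := [spoilA], pos := [inA 0, at1 .nrange 0] },
    { head := [spoilA], pos := [outA 0, at1 .nrange 0] },
    { head := [spoilA], cond := [⟨[0], at1 .nrange 0, undA 0⟩] } }

/-- The encoding of the semantics `σ`. -/
def encoding (σ : Semantics) : Program α :=
  match σ with
  | .co => encCo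
  | .st => encSt
  | .pr => encPr
  | .sst => encSst

end Encodings

end ArgASP

open ArgASP

/-!
The proof has two independent halves.

For an arbitrary encoding the argument is a splitting argument. The strong and weak constraints
derive only atoms over the fresh predicate `w`, so the answer sets of the program that is built are
the answer sets `M₀` of the encoding in which the goal satisfies its literal, each extended by the
atoms `w(a)` whose bodies hold in `M₀` (`mem_answerSets_added_iff`). If `M₀` represents `L'`, the
number of satisfied preference elements is the number of `a ≠ g` on which `L'` differs from `L`
(counterfactuals) or agrees with `L` (semifactuals). As the goal itself contributes a constant,
minimizing this number is minimizing, respectively maximizing, the distance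
(`mem_explanations_iff`). Since the atoms over `w` are a function of `M₀`, a labelling is
represented once among the returned answer sets if it is among those of the encoding.

For the concrete encodings, the answer sets are computed explicitly: for each extension `E` there
is exactly one, `stModel Λ E` or `coModel Λ E ..`. All that an answer set contains beyond what the
set of its arguments labelled `in` determines could be removed without violating the reduct, which
gives one inclusion; the rules give the other. The preferred and semi-stable encodings use
saturation (`mem_answerSets_saturated_iff`): an answer set contains `spoil` and therefore every
`wit(a)` and `nwit(a)`, and it is minimal exactly if no choice of a witness avoids `spoil`, that is,
if no admissible set properly contains `E`, or has a properly larger range. That these conditions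
on admissible sets amount to the preferred and semi-stable semantics follows from Dung's
fundamental lemma, by which an admissible set of a finite framework extends to a preferred
extension.
-/

namespace ArgASP

/-! ### Answer sets, rule by rule -/

section AnswerSets

variable {α : Type*}

/-- Every ground instance of `r` that survives in the reduct with respect to `M` is true
in `N`. -/
def Rule.Sat (M N : Set (Atom α)) (r : Rule α) : Prop :=
  ∀ s : ℕ → α, (∀ B ∈ r.pos, B.inst s ∈ N) → (∀ B ∈ r.neg, B.inst s ∉ M) →
    (∀ c ∈ r.cond, ∀ t : ℕ → α, (∀ n, n ∉ c.bound → t n = s n) →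
      c.guard.inst t ∈ M → c.lit.inst t ∈ M) →
    (∀ c ∈ r.cond, ∀ t : ℕ → α, (∀ n, n ∉ c.bound → t n = s n) →
      c.guard.inst t ∈ N → c.lit.inst t ∈ N) →
    ∃ B ∈ r.head, B.inst s ∈ N

theorem isModel_reduct_iff (P : Program α) (M N : Set (Atom α)) :
    IsModel N (reduct (ground P) M) ↔ ∀ r ∈ P, r.Sat M N := by
  constructor
  · intro h r hr s hpos hneg hcM hcN
    obtain ⟨_, ⟨B, hB, rfl⟩, hN⟩ := h { r.inst s with neg := ∅ }
      ⟨r.inst s, ⟨r, hr, s, rfl⟩, by rintro _ ⟨B, hB, rfl⟩; exact hneg B hB,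
        by rintro _ ⟨c, hc, t, ht, rfl⟩; exact hcM c hc t ht, rfl⟩
      (by rintro _ ⟨B, hB, rfl⟩; exact hpos B hB) (by simp)
      (by rintro _ ⟨c, hc, t, ht, rfl⟩; exact hcN c hc t ht)
    exact ⟨B, hB, hN⟩
  · rintro h _ ⟨_, ⟨r, hr, s, rfl⟩, hneg, hcM, rfl⟩ hpos - hcN
    obtain ⟨B, hB, hN⟩ := h r hr s (fun B hB => hpos ⟨B, hB, rfl⟩)
      (fun B hB => hneg _ ⟨B, hB, rfl⟩) (fun c hc t ht => hcM _ ⟨c, hc, t, ht, rfl⟩)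
      (fun c hc t ht => hcN _ ⟨c, hc, t, ht, rfl⟩)
    exact ⟨_, ⟨B, hB, rfl⟩, hN⟩

theorem mem_answerSets_iff (P : Program α) (M : Set (Atom α)) :
    M ∈ answerSets P ↔
      (∀ r ∈ P, r.Sat M M) ∧ ∀ N ⊆ M, (∀ r ∈ P, r.Sat M N) → M ⊆ N := by
  simp only [answerSets, Set.mem_ofPred_eq, Minimal, isModel_reduct_iff]
  exact and_congr_right fun _ => ⟨fun h N hN hs => h hs hN, fun h N hs hN => h N hN hs⟩

theorem Rule.Sat.congr {r : Rule α} {p : Pred} (hr : ¬ r.Mentions p) {M M' N N' : Set (Atom α)}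
    (hM : ∀ A : Atom α, A.pred ≠ p → (A ∈ M ↔ A ∈ M'))
    (hN : ∀ A : Atom α, A.pred ≠ p → (A ∈ N ↔ A ∈ N')) (h : r.Sat M N) : r.Sat M' N' := by
  simp only [Rule.Mentions, not_or, not_exists, not_and] at hr
  obtain ⟨h1, h2, h3, h4⟩ := hr
  intro s hpos hneg hcM hcN
  obtain ⟨B, hB, hBN⟩ := h s (fun B hB => (hN _ (h2 B hB)).2 (hpos B hB))
    (fun B hB => mt (hM _ (h3 B hB)).1 (hneg B hB))
    (fun c hc t ht hg => (hM _ (h4 c hc).1).2 (hcM c hc t ht ((hM _ (h4 c hc).2).1 hg)))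
    (fun c hc t ht hg => (hN _ (h4 c hc).1).2 (hcN c hc t ht ((hN _ (h4 c hc).2).1 hg)))
  exact ⟨B, hB, (hN _ (h1 B hB)).1 hBN⟩

theorem pred_ne_of_mem_answerSets {Q : Program α} {p : Pred} (hQ : ∀ r ∈ Q, ¬ r.Mentions p)
    {M : Set (Atom α)} (hM : M ∈ answerSets Q) : ∀ A ∈ M, A.pred ≠ p := by
  rw [mem_answerSets_iff] at hM
  refine fun A hA => (hM.2 {A ∈ M | A.pred ≠ p} (fun A hA => hA.1) (fun r hr => ?_) hA).2
  exact (hM.1 r hr).congr (hQ r hr) (fun A _ => Iff.rfl) fun A hA => by simp [hA]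

theorem sat_afFacts_iff [Nonempty α] (Λ : AF α) (M N : Set (Atom α)) :
    (∀ r ∈ afFacts Λ, r.Sat M N) ↔
      (∀ a, (⟨.arg, [a]⟩ : Atom α) ∈ N) ∧
      ∀ a b, Λ.att a b → (⟨.att, [a, b]⟩ : Atom α) ∈ N := by
  constructor
  · intro h
    have s : ℕ → α := fun _ => Classical.arbitrary α
    refine ⟨fun a => ?_, fun a b hab => ?_⟩
    · simpa [Rule.Sat, Atom.inst, Term.inst] using h _ (Or.inl ⟨a, rfl⟩) s
    · simpa [Rule.Sat, Atom.inst, Term.inst] using h _ (Or.inr ⟨a, b, hab, rfl⟩) s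
  · rintro ⟨h1, h2⟩ r (⟨a, rfl⟩ | ⟨a, b, hab, rfl⟩) s <;>
      simp [Atom.inst, Term.inst, *]

theorem not_mentions_w_of_mem_afFacts {Λ : AF α} {r : Rule α} (hr : r ∈ afFacts Λ) :
    ¬ r.Mentions .w := by
  rcases hr with ⟨a, rfl⟩ | ⟨a, b, -, rfl⟩ <;> simp [Rule.Mentions]

end AnswerSets

/-! ### Splitting off the weak constraints -/

section Splitting

variable {α : Type*}

/-- The ground literal for `a` on which both kinds of added rules are based: `not ℓ(L,a)` for
counterfactuals and `ℓ(L,a)` for semifactuals. The weak constraint of `a` fires if it holds, and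
the strong constraint demands it for the goal. -/
def LabelLit (T : TaskType) (L : Labelling α) (M : Set (Atom α)) (a : α) : Prop :=
  match T with
  | .CF => (⟨.lab (L a), [a]⟩ : Atom α) ∉ M
  | .SF => (⟨.lab (L a), [a]⟩ : Atom α) ∈ M

/-- The atoms `w(a)` derived by the weak constraints from `M`. -/
def weakAtoms (T : TaskType) (L : Labelling α) (g : α) (M : Set (Atom α)) : Set (Atom α) :=
  {A | ∃ a, a ≠ g ∧ LabelLit T L M a ∧ A = ⟨.w, [a]⟩}

/-- The strong and weak constraints hold in `N` if, evaluated in the larger `M`, the goal satisfies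
its literal and `N` contains the weak atoms. A label atom that occurs positively in a body is true
in `M` whenever it is true in `N`, so evaluating it in `M` only strengthens the hypotheses. -/
theorem sat_added_of {T : TaskType} {L : Labelling α} {g : α} {M N : Set (Atom α)} (hN : N ⊆ M)
    (hg : LabelLit T L M g) (hw : weakAtoms T L g M ⊆ N) :
    ∀ r ∈ strongConstraint T L g ∪ weakConstraints T L g, r.Sat M N := by
  rintro r (hr | hr)
  · cases T
    · obtain rfl : r = _ := hr
      intro s hpos
      exact absurd (hN (by simpa [labelAtom, Atom.inst, Term.inst] using hpos)) hg
    · obtain rfl : r = _ := hr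
      intro s _ hneg
      exact absurd hg (by simpa [LabelLit, labelAtom, Atom.inst, Term.inst] using hneg)
  · cases T
    · obtain ⟨a, ha, rfl⟩ := hr
      intro s _ hneg _ _
      refine ⟨_, List.mem_singleton_self _, hw ⟨a, ha, ?_, rfl⟩⟩
      simpa [LabelLit, labelAtom, Atom.inst, Term.inst] using hneg
    · obtain ⟨a, ha, rfl⟩ := hr
      intro s hpos _ _ _
      refine ⟨_, List.mem_singleton_self _, hw ⟨a, ha, hN ?_, rfl⟩⟩
      simpa [LabelLit, labelAtom, Atom.inst, Term.inst] using hpos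

theorem labelLit_of_sat {T : TaskType} {L : Labelling α} {g : α} {M : Set (Atom α)}
    (h : ∀ r ∈ strongConstraint T L g, r.Sat M M) : LabelLit T L M g := by
  cases T
  · have := h _ rfl (fun _ => g)
    simpa [LabelLit, labelAtom, Atom.inst, Term.inst] using this
  · have := h _ rfl (fun _ => g)
    simpa [LabelLit, labelAtom, Atom.inst, Term.inst] using this

theorem weakAtoms_subset_of_sat {T : TaskType} {L : Labelling α} {g : α} {M N : Set (Atom α)}
    (hMN : ∀ a l, (⟨.lab l, [a]⟩ : Atom α) ∈ M → (⟨.lab l, [a]⟩ : Atom α) ∈ N)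
    (h : ∀ r ∈ weakConstraints T L g, r.Sat M N) : weakAtoms T L g M ⊆ N := by
  rintro _ ⟨a, ha, hl, rfl⟩
  cases T
  · have := h _ ⟨a, ha, rfl⟩ (fun _ => g)
    simpa [labelAtom, Atom.inst, Term.inst, show _ ∉ M from hl] using this
  · have := h _ ⟨a, ha, rfl⟩ (fun _ => g)
    simpa [labelAtom, Atom.inst, Term.inst, hMN _ _ hl] using this

theorem labelLit_congr {T : TaskType} {L : Labelling α} {M M' : Set (Atom α)}
    (h : ∀ A : Atom α, A.pred ≠ .w → (A ∈ M ↔ A ∈ M')) (a : α) :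
    LabelLit T L M a ↔ LabelLit T L M' a := by
  cases T <;> simp [LabelLit, h]

theorem weakAtoms_congr {T : TaskType} {L : Labelling α} {g : α} {M M' : Set (Atom α)}
    (h : ∀ A : Atom α, A.pred ≠ .w → (A ∈ M ↔ A ∈ M')) :
    weakAtoms T L g M = weakAtoms T L g M' := by
  simp only [weakAtoms, labelLit_congr h]

theorem pred_of_mem_weakAtoms {T : TaskType} {L : Labelling α} {g : α} {M : Set (Atom α)}
    {A : Atom α} (h : A ∈ weakAtoms T L g M) : A.pred = .w := by
  obtain ⟨a, -, -, rfl⟩ := h; rfl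

/-- Adding the strong and the weak constraints to a program `Q` without the predicate `w` selects
the answer sets of `Q` in which the goal satisfies its literal, and extends each of them by its
weak atoms. This is an instance of splitting: no head of the added rules occurs in `Q`. -/
theorem mem_answerSets_added_iff {Q : Program α} (hQ : ∀ r ∈ Q, ¬ r.Mentions .w) {T : TaskType}
    {L : Labelling α} {g : α} {M : Set (Atom α)} :
    M ∈ answerSets (Q ∪ (strongConstraint T L g ∪ weakConstraints T L g)) ↔
      ∃ M₀ ∈ answerSets Q, LabelLit T L M₀ g ∧ M = M₀ ∪ weakAtoms T L g M₀ := by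
  constructor
  · intro h
    rw [mem_answerSets_iff] at h
    obtain ⟨hM, hmin⟩ := h
    have hg : LabelLit T L M g := labelLit_of_sat fun r hr => hM r (Or.inr (Or.inl hr))
    have hw : weakAtoms T L g M ⊆ M :=
      weakAtoms_subset_of_sat (fun _ _ => id) fun r hr => hM r (Or.inr (Or.inr hr))
    set M₀ : Set (Atom α) := {A ∈ M | A.pred ≠ .w} with hM₀
    have hag : ∀ A : Atom α, A.pred ≠ .w → (A ∈ M ↔ A ∈ M₀) := fun A hA => by simp [hM₀, hA]
    -- A model of the reduct of `Q` inside `M₀` becomes one of the whole reduct with the weak atoms.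
    have key : ∀ N ⊆ M₀, (∀ r ∈ Q, r.Sat M₀ N) → M ⊆ N ∪ weakAtoms T L g M := by
      intro N hN hs
      have hsub : N ∪ weakAtoms T L g M ⊆ M :=
        Set.union_subset (hN.trans fun A hA => hA.1) hw
      refine hmin _ hsub ?_
      rintro r (hr | hr)
      · refine (hs r hr).congr (hQ r hr) (fun A hA => (hag A hA).symm) fun A hA => ?_
        exact ⟨Or.inl, fun h => h.resolve_right fun h' => hA (pred_of_mem_weakAtoms h')⟩
      · exact sat_added_of hsub hg Set.subset_union_right r hr
    have hs₀ : ∀ r ∈ Q, r.Sat M₀ M₀ := fun r hr =>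
      (hM r (Or.inl hr)).congr (hQ r hr) hag hag
    refine ⟨M₀, (mem_answerSets_iff _ _).2 ⟨hs₀, fun N hN hs A hA => ?_⟩,
      (labelLit_congr hag g).1 hg, ?_⟩
    · exact (key N hN hs hA.1).resolve_right fun h' => hA.2 (pred_of_mem_weakAtoms h')
    · rw [← weakAtoms_congr hag]
      exact (key M₀ subset_rfl hs₀).antisymm (Set.union_subset (fun A hA => hA.1) hw)
  · rintro ⟨M₀, h, hg, rfl⟩
    rw [mem_answerSets_iff] at h
    obtain ⟨hM, hmin⟩ := h
    set M := M₀ ∪ weakAtoms T L g M₀ with hMdef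
    have hag : ∀ A : Atom α, A.pred ≠ .w → (A ∈ M₀ ↔ A ∈ M) := fun A hA =>
      ⟨Or.inl, fun h => h.resolve_right fun h' => hA (pred_of_mem_weakAtoms h')⟩
    rw [mem_answerSets_iff]
    refine ⟨?_, fun N hN hs => ?_⟩
    · rintro r (hr | hr)
      · exact (hM r hr).congr (hQ r hr) hag hag
      · refine sat_added_of subset_rfl ((labelLit_congr hag g).1 hg) ?_ r hr
        rw [← weakAtoms_congr hag]
        exact Set.subset_union_right
    · have h₀ : M₀ ⊆ N := by
        refine fun A hA => (hmin {A ∈ N | A.pred ≠ .w} ?_ (fun r hr => ?_) hA).1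
        · exact fun A hA => (hag A hA.2).2 (hN hA.1)
        · exact (hs r (Or.inl hr)).congr (hQ r hr) (fun A hA => (hag A hA).symm)
            fun A hA => by simp [hA]
      refine Set.union_subset h₀ ?_
      rw [weakAtoms_congr hag]
      refine weakAtoms_subset_of_sat (fun a l h => h₀ ((hag _ ?_).2 h))
        fun r hr => hs r (Or.inr (Or.inr hr))
      simp

end Splitting

/-! ### Soundness and completeness for an arbitrary encoding -/

section Explain

variable {α : Type*}

/-- The literal `LabelLit`, read as a condition on a labelling `L'` instead of an answer set: `L'`
differs from `L` at `a` (counterfactuals) or agrees with it (semifactuals). Candidate labellings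
satisfy it at the goal, and pay one satisfied preference element for every other such argument. -/
def Pays (T : TaskType) (L L' : Labelling α) (a : α) : Prop :=
  match T with
  | .CF => L a ≠ L' a
  | .SF => L a = L' a

/-- The number of preference elements satisfied by the answer sets that represent `L'`. -/
noncomputable def cost (T : TaskType) (L : Labelling α) (g : α) (L' : Labelling α) : ℕ :=
  {a | a ≠ g ∧ Pays T L L' a}.ncard

theorem Represents.labelLit_iff {M : Set (Atom α)} {L' : Labelling α} (h : Represents M L')
    (T : TaskType) (L : Labelling α) (a : α) : LabelLit T L M a ↔ Pays T L L' a := by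
  cases T <;> simp [LabelLit, Pays, h a, eq_comm]

theorem Represents.unique {M : Set (Atom α)} {L L' : Labelling α} (h : Represents M L)
    (h' : Represents M L') : L = L' :=
  funext fun a => (h a _).1 ((h' a _).2 rfl)

theorem Represents.union_weakAtoms_iff {M W : Set (Atom α)} {L' : Labelling α}
    (hW : ∀ A ∈ W, A.pred = .w) : Represents (M ∪ W) L' ↔ Represents M L' := by
  have : ∀ a l, (⟨.lab l, [a]⟩ : Atom α) ∉ W := fun a l h => by simpa using hW _ h
  simp [Represents, this]

theorem ncard_setOf_pays [Finite α] {T : TaskType} {L L' : Labelling α} {g : α}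
    (h : Pays T L L' g) : {a | Pays T L L' a}.ncard = cost T L g L' + 1 := by
  rw [cost, ← Set.ncard_insert_of_notMem (a := g) (by simp) (Set.toFinite _)]
  congr 1
  ext a
  by_cases ha : a = g <;> simp [ha, h]

/-- Among the candidate labellings, minimal cost means minimal distance for counterfactuals and
maximal distance for semifactuals; the goal contributes the same to all of them. -/
theorem mem_explanations_iff [Finite α] {T : TaskType} {Λ : AF α} {σ : Semantics} {g : α}
    {L L' : Labelling α} :
    L' ∈ explanations T Λ σ g L ↔ L' ∈ Λ.labellings σ ∧ Pays T L L' g ∧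
      ∀ L'' ∈ Λ.labellings σ, Pays T L L'' g → cost T L g L' ≤ cost T L g L'' := by
  cases T
  · have hd : ∀ L', Pays .CF L L' g → labDist L L' = cost .CF L g L' + 1 := fun L' h =>
      ncard_setOf_pays h
    constructor
    · rintro ⟨h1, h2, h3⟩
      refine ⟨h1, h2, fun L'' h h' => ?_⟩
      by_contra hlt
      exact h3 ⟨L'', h, h', by rw [hd _ h', hd _ h2]; omega⟩
    · rintro ⟨h1, h2, h3⟩
      refine ⟨h1, h2, ?_⟩
      rintro ⟨L'', h, h', hlt⟩
      have := h3 L'' h h'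
      rw [hd _ h', hd _ h2] at hlt
      omega
  · have hd : ∀ L', Pays .SF L L' g → cost .SF L g L' + 1 + labDist L L' = Nat.card α :=
      fun L' h => by
        rw [← ncard_setOf_pays h, labDist, ← Set.ncard_add_ncard_compl {a | Pays .SF L L' a}]
        rfl
    constructor
    · rintro ⟨h1, h2, h3⟩
      refine ⟨h1, h2, fun L'' h h' => ?_⟩
      by_contra hlt
      have e1 := hd _ h2
      have e2 := hd _ h'
      exact h3 ⟨L'', h, h', by omega⟩
    · rintro ⟨h1, h2, h3⟩
      refine ⟨h1, h2, ?_⟩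
      rintro ⟨L'', h, h', hlt⟩
      have := h3 L'' h h'
      have e1 := hd _ h2
      have e2 := hd _ h'
      omega

theorem ncard_heldElems {T : TaskType} {L L' : Labelling α} {g : α} {M₀ : Set (Atom α)}
    (hw : ∀ A ∈ M₀, A.pred ≠ .w) (harg : ∀ a, (⟨.arg, [a]⟩ : Atom α) ∈ M₀)
    (hL' : Represents M₀ L') :
    (heldElems prefElems (M₀ ∪ weakAtoms T L g M₀)).ncard = cost T L g L' := by
  have : heldElems prefElems (M₀ ∪ weakAtoms T L g M₀) =
      (fun a => (⟨.w, [a]⟩ : Atom α)) '' {a | a ≠ g ∧ Pays T L L' a} := by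
    ext A
    constructor
    · rintro ⟨_, rfl, s, rfl, h | ⟨a, ha, hl, h⟩, -⟩
      · exact absurd rfl (hw _ h)
      · exact ⟨a, ⟨ha, (hL'.labelLit_iff T L a).1 hl⟩, h.symm⟩
    · rintro ⟨a, ⟨ha, hl⟩, rfl⟩
      exact ⟨_, rfl, fun _ => a, rfl, Or.inr ⟨a, ha, (hL'.labelLit_iff T L a).2 hl, rfl⟩,
        Or.inl (harg a)⟩
  rw [this, cost, Set.ncard_image_of_injective]
  intro a b h
  simpa using h

theorem IsEncoding.not_mentions {σ : Semantics} {Λ : AF α} {P : Program α}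
    (hP : IsEncoding σ Λ P) : ∀ r ∈ P ∪ afFacts Λ, ¬ r.Mentions .w := by
  rintro r (hr | hr)
  exacts [hP.1 r hr, not_mentions_w_of_mem_afFacts hr]

theorem ncard_heldElems_of_mem_answerSets {σ : Semantics} {Λ : AF α} {P : Program α}
    (hP : IsEncoding σ Λ P) {M₀ : Set (Atom α)} (hM₀ : M₀ ∈ answerSets (P ∪ afFacts Λ))
    {T : TaskType} {L L' : Labelling α} (g : α) (hL' : Represents M₀ L') :
    (heldElems prefElems (M₀ ∪ weakAtoms T L g M₀)).ncard = cost T L g L' := by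
  refine ncard_heldElems (pred_ne_of_mem_answerSets hP.not_mentions hM₀) ?_ hL'
  have : Nonempty α := ⟨g⟩
  rw [mem_answerSets_iff] at hM₀
  exact ((sat_afFacts_iff Λ M₀ M₀).1 fun r hr => hM₀.1 r (Or.inr hr)).1

/-- The answer sets returned for an encoding are the answer sets of the encoding that represent an
explanation, each of them extended by its weak atoms. -/
theorem IsEncoding.mem_explain_iff [Finite α] {σ : Semantics} {Λ : AF α} {P : Program α}
    (hP : IsEncoding σ Λ P) {T : TaskType} {L : Labelling α} {g : α} {M : Set (Atom α)} :
    M ∈ explain Λ g L T P ↔ ∃ M₀ ∈ answerSets (P ∪ afFacts Λ),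
      M = M₀ ∪ weakAtoms T L g M₀ ∧ ∃ L' ∈ explanations T Λ σ g L, Represents M₀ L' := by
  have hprog : afFacts Λ ∪ P ∪ strongConstraint T L g ∪ weakConstraints T L g =
      (P ∪ afFacts Λ) ∪ (strongConstraint T L g ∪ weakConstraints T L g) := by
    rw [Set.union_comm (afFacts Λ) P, Set.union_assoc]
  simp only [explain, asprin, hprog, Set.mem_ofPred_eq, mem_answerSets_added_iff hP.not_mentions]
  constructor
  · rintro ⟨⟨M₀, hM₀, hg, rfl⟩, hopt⟩
    obtain ⟨L', hL', hrep⟩ := hP.2.1 M₀ hM₀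
    refine ⟨M₀, hM₀, rfl, L', mem_explanations_iff.2
      ⟨hL', (hrep.labelLit_iff T L g).1 hg, fun L'' hL'' hg'' => ?_⟩, hrep⟩
    obtain ⟨N₀, hN₀, hrep''⟩ := hP.2.2 L'' hL''
    by_contra hlt
    refine hopt ⟨_, ⟨N₀, hN₀, (hrep''.labelLit_iff T L g).2 hg'', rfl⟩, ?_⟩
    rw [ncard_heldElems_of_mem_answerSets hP hN₀ g hrep'',
      ncard_heldElems_of_mem_answerSets hP hM₀ g hrep]
    omega
  · rintro ⟨M₀, hM₀, rfl, L', hL', hrep⟩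
    obtain ⟨-, hg, hmin⟩ := mem_explanations_iff.1 hL'
    refine ⟨⟨M₀, hM₀, (hrep.labelLit_iff T L g).2 hg, rfl⟩, ?_⟩
    rintro ⟨_, ⟨N₀, hN₀, hg'', rfl⟩, hlt⟩
    obtain ⟨L'', hL'', hrep''⟩ := hP.2.1 N₀ hN₀
    rw [ncard_heldElems_of_mem_answerSets hP hN₀ g hrep'',
      ncard_heldElems_of_mem_answerSets hP hM₀ g hrep] at hlt
    exact absurd (hmin L'' hL'' ((hrep''.labelLit_iff T L g).1 hg'')) (by omega)

theorem represents_union_weakAtoms_iff {T : TaskType} {L L' : Labelling α} {g : α}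
    {M : Set (Atom α)} : Represents (M ∪ weakAtoms T L g M) L' ↔ Represents M L' :=
  Represents.union_weakAtoms_iff fun _ => pred_of_mem_weakAtoms

theorem IsEncoding.explain_sound [Finite α] {σ : Semantics} {Λ : AF α} {P : Program α}
    (hP : IsEncoding σ Λ P) {T : TaskType} {L : Labelling α} {g : α} {M : Set (Atom α)}
    (hM : M ∈ explain Λ g L T P) : ∃ L' ∈ explanations T Λ σ g L, Represents M L' := by
  obtain ⟨M₀, -, rfl, L', hL', hrep⟩ := hP.mem_explain_iff.1 hM
  exact ⟨L', hL', represents_union_weakAtoms_iff.2 hrep⟩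

theorem IsEncoding.explain_complete [Finite α] {σ : Semantics} {Λ : AF α} {P : Program α}
    (hP : IsEncoding σ Λ P) {T : TaskType} {L L' : Labelling α} {g : α}
    (hL' : L' ∈ explanations T Λ σ g L) : ∃ M ∈ explain Λ g L T P, Represents M L' := by
  obtain ⟨M₀, hM₀, hrep⟩ := hP.2.2 L' (mem_explanations_iff.1 hL').1
  exact ⟨_, hP.mem_explain_iff.2 ⟨M₀, hM₀, rfl, L', hL', hrep⟩,
    represents_union_weakAtoms_iff.2 hrep⟩

/-- If no two answer sets of the encoding represent the same labelling, then no two returned ones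
do: the weak atoms are a function of the rest. -/
theorem IsEncoding.explain_unique [Finite α] {σ : Semantics} {Λ : AF α} {P : Program α}
    (hP : IsEncoding σ Λ P)
    (huniq : ∀ M ∈ answerSets (P ∪ afFacts Λ), ∀ N ∈ answerSets (P ∪ afFacts Λ),
      ∀ L', Represents M L' → Represents N L' → M = N)
    {T : TaskType} {L L' : Labelling α} {g : α} (hL' : L' ∈ explanations T Λ σ g L) :
    ∃! M, M ∈ explain Λ g L T P ∧ Represents M L' := by
  obtain ⟨M, hM, hrep⟩ := hP.explain_complete hL'
  refine ⟨M, ⟨hM, hrep⟩, ?_⟩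
  rintro N ⟨hN, hrepN⟩
  obtain ⟨M₀, hM₀, rfl, -⟩ := hP.mem_explain_iff.1 hM
  obtain ⟨N₀, hN₀, rfl, -⟩ := hP.mem_explain_iff.1 hN
  rw [huniq N₀ hN₀ M₀ hM₀ L' (represents_union_weakAtoms_iff.1 hrepN)
    (represents_union_weakAtoms_iff.1 hrep)]

end Explain

/-! ### Extensions of finite argumentation frameworks -/

namespace AF

variable {α : Type*} {Λ : AF α} {S S' : Set α} {a : α}

theorem defeated_mono (h : S ⊆ S') : Λ.defeated S ⊆ Λ.defeated S' :=
  fun _ ⟨b, hb, hba⟩ => ⟨b, h hb, hba⟩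

theorem acceptable_mono (h : S ⊆ S') : Λ.acceptable S ⊆ Λ.acceptable S' :=
  fun _ ha b hb => defeated_mono h (ha b hb)

theorem ConflictFree.notMem_defeated (h : Λ.ConflictFree S) (ha : a ∈ S) : a ∉ Λ.defeated S :=
  fun ha' => (h ▸ ⟨ha, ha'⟩ : a ∈ (∅ : Set α))

theorem conflictFree_iff : Λ.ConflictFree S ↔ ∀ a ∈ S, a ∉ Λ.defeated S :=
  ⟨fun h _ => h.notMem_defeated, fun h => Set.eq_empty_of_forall_notMem fun a ha => h a ha.1 ha.2⟩

/-- Dung's fundamental lemma. -/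
theorem Admissible.insert_of_mem_acceptable (h : Λ.Admissible S) (ha : a ∈ Λ.acceptable S) :
    Λ.Admissible (insert a S) := by
  have hmono : Λ.acceptable S ⊆ Λ.acceptable (insert a S) :=
    acceptable_mono (Set.subset_insert a S)
  -- An attack of `S` on `a` or of `a` on itself or on `S` would be answered from within `S`.
  have hSa : a ∉ Λ.defeated S := by
    rintro ⟨t, ht, hta⟩
    exact h.1.notMem_defeated ht (ha t hta)
  refine ⟨conflictFree_iff.2 ?_, Set.insert_subset (hmono ha) (h.2.trans hmono)⟩
  rintro b hb ⟨t, rfl | ht, htb⟩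
  · rcases hb with rfl | hb
    · exact hSa (ha _ htb)
    · exact hSa (h.2 hb _ htb)
  · rcases hb with rfl | hb
    · exact hSa ⟨t, ht, htb⟩
    · exact h.1.notMem_defeated hb ⟨t, ht, htb⟩

theorem Admissible.exists_preferred [Finite α] (h : Λ.Admissible S) :
    ∃ S', S ⊆ S' ∧ Λ.Preferred S' := by
  obtain ⟨S', hS, hmax⟩ := Set.Finite.exists_le_maximal (Set.toFinite {S | Λ.Admissible S}) h
  refine ⟨S', hS, ⟨hmax.prop, ?_⟩, fun T hT hle => hmax.2 hT.1 hle⟩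
  refine hmax.prop.2.antisymm fun a ha => ?_
  exact hmax.2 (hmax.prop.insert_of_mem_acceptable ha) (Set.subset_insert a S') (Set.mem_insert a S')

theorem stable_iff : Λ.Stable S ↔ ∀ a, a ∈ S ↔ a ∉ Λ.defeated S := by
  constructor
  · rintro ⟨hp, hu⟩ a
    exact ⟨hp.prop.1.1.notMem_defeated, (hu.ge (Set.mem_univ a)).resolve_right⟩
  · intro h
    have hcf : Λ.ConflictFree S := conflictFree_iff.2 fun a => (h a).1
    refine ⟨⟨⟨⟨hcf, fun a ha b hb => ?_⟩, ?_⟩, fun S' hS' hle a ha => (h a).2 fun ha' => ?_⟩, ?_⟩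
    · by_contra hb'
      exact (h a).1 ha ⟨b, (h b).2 hb', hb⟩
    · refine Set.Subset.antisymm (fun a ha b hb => ?_) fun a ha => (h a).2 ?_
      · by_contra hb'
        exact (h a).1 ha ⟨b, (h b).2 hb', hb⟩
      · rintro ⟨b, hb, hba⟩
        exact (h b).1 hb (ha b hba)
    · exact hS'.1.1.notMem_defeated ha (defeated_mono hle ha')
    · exact Set.eq_univ_of_forall fun a => or_iff_not_imp_right.2 (h a).2

theorem preferred_iff [Finite α] :
    Λ.Preferred S ↔ Λ.Complete S ∧ ∀ S', Λ.Admissible S' → ¬ S ⊂ S' := by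
  constructor
  · refine fun h => ⟨h.prop, fun S' hS' hlt => ?_⟩
    obtain ⟨S'', hle, hp⟩ := hS'.exists_preferred
    exact hlt.2 (hle.trans (h.2 hp.prop (hlt.1.trans hle)))
  · rintro ⟨hc, h⟩
    exact ⟨hc, fun S' hS' hle => by_contra fun hn => h S' hS'.1 ⟨hle, hn⟩⟩

/-- A semi-stable extension is a complete one whose range is maximal among the ranges of all
admissible sets: an admissible set is contained in a preferred extension, and a complete
extension that is properly contained in an admissible set has a properly smaller range. -/
theorem semiStable_iff [Finite α] :
    Λ.SemiStable S ↔ Λ.Complete S ∧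
      ∀ S', Λ.Admissible S' → ¬ S ∪ Λ.defeated S ⊂ S' ∪ Λ.defeated S' := by
  constructor
  · refine fun h => ⟨h.1.prop, fun S' hS' hlt => ?_⟩
    obtain ⟨S'', hle, hp⟩ := hS'.exists_preferred
    have hr := Set.union_subset_union hle (Λ.defeated_mono hle)
    exact hlt.2 (hr.trans (h.2 S'' hp (hlt.1.trans hr)))
  · rintro ⟨hc, h⟩
    refine ⟨preferred_iff.2 ⟨hc, fun S' hS' hlt => h S' hS' ⟨?_, fun hr => hlt.2 fun a ha => ?_⟩⟩,
      fun S' hS' hle => by_contra fun hn => h S' hS'.prop.1 ⟨hle, hn⟩⟩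
    · exact Set.union_subset_union hlt.1 (Λ.defeated_mono hlt.1)
    · exact (hr (Or.inl ha)).resolve_right fun ha' =>
        hS'.1.notMem_defeated ha (defeated_mono hlt.1 ha')

theorem Extension.conflictFree {σ : Semantics} (h : Λ.Extension σ S) : Λ.ConflictFree S := by
  cases σ
  exacts [h.1.1, h.1.prop.1.1, h.prop.1.1, h.1.prop.1.1]

theorem labellingOf_eq_inn_iff : Λ.labellingOf S a = .inn ↔ a ∈ S := by
  unfold labellingOf
  split_ifs <;> simp [*]

theorem labellingOf_eq_out_iff (h : Λ.ConflictFree S) :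
    Λ.labellingOf S a = .out ↔ a ∈ Λ.defeated S := by
  have := h.notMem_defeated (a := a)
  unfold labellingOf
  split_ifs <;> simp_all

theorem labellingOf_eq_und_iff : Λ.labellingOf S a = .und ↔ a ∉ S ∧ a ∉ Λ.defeated S := by
  unfold labellingOf
  split_ifs <;> simp [*]

theorem labellingOf_injective : Function.Injective Λ.labellingOf := fun S S' h =>
  Set.ext fun a => by rw [← labellingOf_eq_inn_iff, h, labellingOf_eq_inn_iff]

end AF

section Encodings

variable {α : Type*}

/-- A canonical description `K` of the answer sets makes a program an encoding, in which no
labelling is represented twice. -/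
theorem isEncoding_of_answerSets {σ : Semantics} {Λ : AF α} {P : Program α}
    (K : Set α → Set (Atom α)) (hw : ∀ r ∈ P, ¬ r.Mentions .w)
    (hK : ∀ M, M ∈ answerSets (P ∪ afFacts Λ) ↔ ∃ E, Λ.Extension σ E ∧ M = K E)
    (hrep : ∀ E, Λ.Extension σ E → Represents (K E) (Λ.labellingOf E)) :
    IsEncoding σ Λ P ∧
      ∀ M ∈ answerSets (P ∪ afFacts Λ), ∀ N ∈ answerSets (P ∪ afFacts Λ),
        ∀ L', Represents M L' → Represents N L' → M = N := by
  refine ⟨⟨hw, fun M hM => ?_, ?_⟩, fun M hM N hN L' hML hNL => ?_⟩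
  · obtain ⟨E, hE, rfl⟩ := (hK M).1 hM
    exact ⟨_, ⟨E, hE, rfl⟩, hrep E hE⟩
  · rintro _ ⟨E, hE, rfl⟩
    exact ⟨K E, (hK _).2 ⟨E, hE, rfl⟩, hrep E hE⟩
  · obtain ⟨E, hE, rfl⟩ := (hK M).1 hM
    obtain ⟨E', hE', rfl⟩ := (hK N).1 hN
    rw [AF.labellingOf_injective (((hrep E hE).unique hML).trans ((hrep E' hE').unique hNL).symm)]

/-- The ground atom `p(l)` is true in `M`. -/
def Has (M : Set (Atom α)) (p : Pred) (l : List α) : Prop := (⟨p, l⟩ : Atom α) ∈ M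

theorem Has.mono {M N : Set (Atom α)} (h : M ⊆ N) {p : Pred} {l : List α} (hM : Has M p l) :
    Has N p l := h hM

@[simp]
theorem has_inter {M N : Set (Atom α)} {p : Pred} {l : List α} :
    Has (M ∩ N) p l ↔ Has M p l ∧ Has N p l := Iff.rfl

theorem forall_mem_union {P Q : Program α} {p : Rule α → Prop} :
    (∀ r ∈ P ∪ Q, p r) ↔ (∀ r ∈ P, p r) ∧ ∀ r ∈ Q, p r := by
  simp only [Set.mem_union, or_imp, forall_and]

/-- The facts describing `Λ` belong to `N`. -/
def HasFacts (Λ : AF α) (N : Set (Atom α)) : Prop :=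
  (∀ a, Has N .arg [a]) ∧ ∀ a b, Λ.att a b → Has N .att [a, b]

/-- If every head atom of a rule lies in `K`, then cutting a model down to `K` preserves the
rule. -/
theorem Rule.Sat.inter {r : Rule α} {M K : Set (Atom α)} (h : r.Sat M M)
    (hK : ∀ B ∈ r.head, ∀ s, B.inst s ∈ K) : r.Sat M (M ∩ K) := by
  intro s hpos hneg hc _
  obtain ⟨B, hB, hM⟩ := h s (fun B hB => (hpos B hB).1) hneg hc hc
  exact ⟨B, hB, hM, hK B hB s⟩

/-! ### The stable encoding -/

/-- The rules of `encSt`, read in the reduct with respect to `M`. -/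
structure StRules (M N : Set (Atom α)) : Prop where
  inn : ∀ a, Has N .arg [a] → ¬ Has M (.lab .out) [a] → Has N (.lab .inn) [a]
  out : ∀ a, Has N .arg [a] → ¬ Has M (.lab .inn) [a] → Has N (.lab .out) [a]
  defeated : ∀ a b, Has N (.lab .inn) [b] → Has N .att [b, a] → Has N .defeated [a]
  conflict : ∀ a b, Has N (.lab .inn) [a] → Has N (.lab .inn) [b] → ¬ Has N .att [a, b]
  undefeated : ∀ a, Has N (.lab .out) [a] → Has M .defeated [a]

theorem sat_encSt_iff {M N : Set (Atom α)} : (∀ r ∈ encSt, r.Sat M N) ↔ StRules M N := by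
  simp only [encSt, Set.mem_insert_iff, Set.mem_singleton_iff, forall_eq_or_imp, forall_eq,
    Rule.Sat, List.mem_cons, List.not_mem_nil, or_false, IsEmpty.forall_iff, implies_true,
    forall_const, exists_eq_left, false_and, exists_false, at1, inA, outA, attA, Atom.inst,
    Term.inst, List.map_cons, List.map_nil]
  constructor
  · rintro ⟨h1, h2, h3, h4, h5⟩
    exact ⟨fun a => h1 fun _ => a, fun a => h2 fun _ => a,
      fun a b h h' => h3 (fun n => if n = 0 then a else b) ⟨h, h'⟩,
      fun a b h h' h'' => h4 (fun n => if n = 0 then a else b) ⟨h, h', h''⟩,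
      fun a h => by_contra fun h' => h5 (fun _ => a) h h'⟩
  · rintro ⟨h1, h2, h3, h4, h5⟩
    exact ⟨fun s => h1 (s 0), fun s => h2 (s 0), fun s h => h3 (s 0) (s 1) h.1 h.2,
      fun s h => h4 (s 0) (s 1) h.1 h.2.1 h.2.2, fun s h h' => h' (h5 (s 0) h)⟩

/-- The atoms of the answer set of the stable encoding that belongs to the extension `E`. -/
def stHolds (Λ : AF α) (E : Set α) : Pred → List α → Prop
  | .arg, [_] => True
  | .att, [a, b] => Λ.att a b
  | .lab .inn, [a] => a ∈ E
  | .lab .out, [a] => a ∉ E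
  | .defeated, [a] => a ∈ Λ.defeated E
  | _, _ => False

/-- The answer set of the stable encoding that belongs to the extension `E`. -/
def stModel (Λ : AF α) (E : Set α) : Set (Atom α) := {A | stHolds Λ E A.pred A.args}

@[simp]
theorem has_stModel {Λ : AF α} {E : Set α} {p : Pred} {l : List α} :
    Has (stModel Λ E) p l ↔ stHolds Λ E p l := Iff.rfl

theorem stModel_subset {Λ : AF α} {E : Set α} {M N : Set (Atom α)} (hM : M ⊆ stModel Λ E)
    (hf : HasFacts Λ N) (h : StRules M N) : stModel Λ E ⊆ N := by
  have hin : ∀ a, a ∈ E → Has N (.lab .inn) [a] := fun a ha =>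
    h.inn a (hf.1 a) fun h' => by simpa [stHolds, ha] using h'.mono hM
  rintro ⟨p, l⟩ hA
  change stHolds Λ E p l at hA
  change Has N p l
  unfold stHolds at hA
  split at hA
  · exact hf.1 _
  · exact hf.2 _ _ hA
  · exact hin _ hA
  · exact h.out _ (hf.1 _) fun h' => hA (by simpa [stHolds] using h'.mono hM)
  · obtain ⟨b, hb, hba⟩ := hA
    exact h.defeated _ b (hin b hb) (hf.2 _ _ hba)
  · exact hA.elim

theorem mem_answerSets_encSt_iff [Nonempty α] {Λ : AF α} {M : Set (Atom α)} :
    M ∈ answerSets (encSt ∪ afFacts Λ) ↔ ∃ E, Λ.Stable E ∧ M = stModel Λ E := by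
  have hsat : ∀ M N, (∀ r ∈ encSt ∪ afFacts Λ, r.Sat M N) ↔ StRules M N ∧ HasFacts Λ N :=
    fun M N => by rw [forall_mem_union, sat_encSt_iff, sat_afFacts_iff]; rfl
  have hK : ∀ E, StRules (stModel Λ E) (stModel Λ E) ↔ Λ.Stable E := by
    intro E
    rw [AF.stable_iff]
    constructor
    · intro h a
      constructor
      · rintro ha ⟨b, hb, hba⟩
        exact h.conflict b a hb ha hba
      · exact fun ha => by_contra fun ha' => ha (h.undefeated a ha')
    · intro h
      refine ⟨?_, ?_, ?_, ?_, ?_⟩ <;> simp only [has_stModel, stHolds]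
      · simp
      · simp
      · exact fun a b hb hba => ⟨b, hb, hba⟩
      · exact fun a b ha hb hab => (h b).1 hb ⟨a, ha, hab⟩
      · exact fun a ha => by_contra fun ha' => ha ((h a).2 ha')
  have hfK : ∀ E, HasFacts Λ (stModel Λ E) := fun E => by simp [HasFacts, stHolds]
  rw [mem_answerSets_iff]
  simp only [hsat]
  constructor
  · rintro ⟨⟨h, hf⟩, hmin⟩
    let E : Set α := {a | Has M (.lab .inn) [a]}
    have hsub : M ⊆ stModel Λ E := by
      refine fun A hA => (hmin (M ∩ stModel Λ E) Set.inter_subset_left ⟨?_, ?_⟩ hA).2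
      · refine ⟨?_, ?_, ?_, ?_, ?_⟩ <;> simp only [has_inter, has_stModel, stHolds]
        · exact fun a ha h' => ⟨h.inn a ha.1 h', h.inn a ha.1 h'⟩
        · exact fun a ha h' => ⟨h.out a ha.1 h', h'⟩
        · exact fun a b hb hba => ⟨h.defeated a b hb.1 hba.1, b, hb.1, hba.2⟩
        · exact fun a b ha hb hab => h.conflict a b ha.1 hb.1 hab.1
        · exact fun a ha => h.undefeated a ha.1
      · exact ⟨fun a => ⟨hf.1 a, trivial⟩, fun a b hab => ⟨hf.2 a b hab, hab⟩⟩
    have heq : M = stModel Λ E := hsub.antisymm (stModel_subset hsub hf h)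
    refine ⟨E, (hK E).1 ?_, heq⟩
    rwa [← heq]
  · rintro ⟨E, hE, rfl⟩
    exact ⟨⟨(hK E).2 hE, hfK E⟩, fun N _ hs => stModel_subset subset_rfl hs.2 hs.1⟩

theorem represents_stModel {Λ : AF α} {E : Set α} (hE : Λ.Stable E) :
    Represents (stModel Λ E) (Λ.labellingOf E) := by
  have h := AF.stable_iff.1 hE
  intro a l
  change stHolds Λ E _ _ ↔ _
  cases l
  · simp [stHolds, AF.labellingOf_eq_inn_iff]
  · simp [stHolds, AF.labellingOf_eq_out_iff hE.1.prop.1.1, h a]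
  · simp [stHolds, AF.labellingOf_eq_und_iff, h a]

/-! ### The complete encoding -/

/-- The rules of `encCo`, read in the reduct with respect to `M`. -/
structure CoRules (M N : Set (Atom α)) : Prop where
  inn : ∀ a, Has N .arg [a] → ¬ Has M .nin [a] → Has N (.lab .inn) [a]
  nin : ∀ a, Has N .arg [a] → ¬ Has M (.lab .inn) [a] → Has N .nin [a]
  out : ∀ a b, Has N (.lab .inn) [b] → Has N .att [b, a] → Has N (.lab .out) [a]
  und : ∀ a, Has N .arg [a] → ¬ Has M (.lab .inn) [a] → ¬ Has M (.lab .out) [a] →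
    Has N (.lab .und) [a]
  undefended : ∀ a b, Has N .att [b, a] → ¬ Has M (.lab .out) [b] → Has N .undefended [a]
  conflict : ∀ a, Has N (.lab .inn) [a] → ¬ Has N (.lab .out) [a]
  defended : ∀ a, Has N (.lab .inn) [a] → ¬ Has N .undefended [a]
  complete : ∀ a, Has N .nin [a] → Has M .undefended [a]

theorem sat_encCo_iff {M N : Set (Atom α)} : (∀ r ∈ encCo, r.Sat M N) ↔ CoRules M N := by
  simp only [encCo, Set.mem_insert_iff, Set.mem_singleton_iff, forall_eq_or_imp, forall_eq,
    Rule.Sat, List.mem_cons, List.not_mem_nil, or_false, IsEmpty.forall_iff, implies_true,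
    forall_const, exists_eq_left, false_and, exists_false, at1, inA, outA, undA, attA, Atom.inst,
    Term.inst, List.map_cons, List.map_nil]
  constructor
  · rintro ⟨h1, h2, h3, h4, h5, h6, h7, h8⟩
    exact ⟨fun a => h1 fun _ => a, fun a => h2 fun _ => a,
      fun a b h h' => h3 (fun n => if n = 0 then a else b) ⟨h, h'⟩,
      fun a h h' h'' => h4 (fun _ => a) h ⟨h', h''⟩,
      fun a b h h' => h5 (fun n => if n = 0 then a else b) h h',
      fun a h h' => h6 (fun _ => a) ⟨h, h'⟩, fun a h h' => h7 (fun _ => a) ⟨h, h'⟩,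
      fun a h => by_contra fun h' => h8 (fun _ => a) h h'⟩
  · rintro ⟨h1, h2, h3, h4, h5, h6, h7, h8⟩
    exact ⟨fun s => h1 (s 0), fun s => h2 (s 0), fun s h => h3 (s 0) (s 1) h.1 h.2,
      fun s h h' => h4 (s 0) h h'.1 h'.2, fun s h h' => h5 (s 0) (s 1) h h',
      fun s h => h6 (s 0) h.1 h.2, fun s h => h7 (s 0) h.1 h.2, fun s h h' => h' (h8 (s 0) h)⟩

/-- The atoms that the encodings of the complete, preferred and semi-stable semantics derive for
the extension `E`, where `wit`, `nwit` and `nrange` hold for the elements of `W`, `V` and `R`, and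
`spoil` holds if `p` does. -/
def coHolds (Λ : AF α) (E W V R : Set α) (p : Prop) : Pred → List α → Prop
  | .arg, [_] => True
  | .att, [a, b] => Λ.att a b
  | .lab .inn, [a] => a ∈ E
  | .lab .out, [a] => a ∈ Λ.defeated E
  | .lab .und, [a] => a ∉ E ∧ a ∉ Λ.defeated E
  | .nin, [a] => a ∉ E
  | .undefended, [a] => a ∉ Λ.acceptable E
  | .wit, [a] => a ∈ W
  | .nwit, [a] => a ∈ V
  | .nrange, [a] => a ∈ R
  | .spoil, [] => p
  | _, _ => False

/-- The interpretation described by `coHolds`. -/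
def coModel (Λ : AF α) (E W V R : Set α) (p : Prop) : Set (Atom α) :=
  {A | coHolds Λ E W V R p A.pred A.args}

variable {Λ : AF α} {E W V R W' V' R' : Set α} {p p' : Prop} {M N : Set (Atom α)}

@[simp]
theorem has_coModel {q : Pred} {l : List α} :
    Has (coModel Λ E W V R p) q l ↔ coHolds Λ E W V R p q l := Iff.rfl

theorem hasFacts_coModel : HasFacts Λ (coModel Λ E W V R p) := by simp [HasFacts, coHolds]

theorem coModel_mono (hW : W ⊆ W') (hV : V ⊆ V') (hR : R ⊆ R') (hp : p → p') :
    coModel Λ E W V R p ⊆ coModel Λ E W' V' R' p' := by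
  rintro ⟨q, l⟩ hA
  change coHolds Λ E W V R p q l at hA
  change coHolds Λ E W' V' R' p' q l
  unfold coHolds at hA
  split at hA <;> simp_all [coHolds, Set.subset_def]

/-- A model of the rules of `encCo` contains all that `E` determines, if the interpretation
defining the reduct derives no more than that. -/
theorem coModel_subset (hM : M ⊆ coModel Λ E W V R p) (hf : HasFacts Λ N) (h : CoRules M N)
    (hW : ∀ a ∈ W', Has N .wit [a]) (hV : ∀ a ∈ V', Has N .nwit [a])
    (hR : ∀ a ∈ R', Has N .nrange [a]) (hp : p' → Has N .spoil []) :
    coModel Λ E W' V' R' p' ⊆ N := by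
  have hin : ∀ a, a ∈ E → Has N (.lab .inn) [a] := fun a ha =>
    h.inn a (hf.1 a) fun h' => by simpa [coHolds, ha] using h'.mono hM
  have hin' : ∀ a, a ∉ E → ¬ Has M (.lab .inn) [a] := fun a ha h' =>
    ha (by simpa [coHolds] using h'.mono hM)
  have hout' : ∀ a, a ∉ Λ.defeated E → ¬ Has M (.lab .out) [a] := fun a ha h' =>
    ha (by simpa [coHolds] using h'.mono hM)
  rintro ⟨q, l⟩ hA
  change coHolds Λ E W' V' R' p' q l at hA
  change Has N q l
  unfold coHolds at hA
  split at hA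
  · exact hf.1 _
  · exact hf.2 _ _ hA
  · exact hin _ hA
  · obtain ⟨b, hb, hba⟩ := hA
    exact h.out _ b (hin b hb) (hf.2 _ _ hba)
  · exact h.und _ (hf.1 _) (hin' _ hA.1) (hout' _ hA.2)
  · exact h.nin _ (hf.1 _) (hin' _ hA)
  · simp only [AF.acceptable, Set.mem_ofPred_eq, not_forall] at hA
    obtain ⟨b, hba, hb⟩ := hA
    exact h.undefended _ b (hf.2 _ _ hba) (hout' _ hb)
  · exact hW _ hA
  · exact hV _ hA
  · exact hR _ hA
  · exact hp hA
  · exact hA.elim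

theorem coRules_coModel_iff :
    CoRules (coModel Λ E W V R p) (coModel Λ E W' V' R' p') ↔ Λ.Complete E := by
  constructor
  · intro h
    have hacc : E ⊆ Λ.acceptable E := fun a ha => by_contra fun ha' => h.defended a ha ha'
    exact ⟨⟨AF.conflictFree_iff.2 h.conflict, hacc⟩,
      hacc.antisymm fun a ha => by_contra fun ha' => h.complete a ha' ha⟩
  · rintro ⟨⟨hcf, -⟩, heq⟩
    refine ⟨?_, ?_, ?_, ?_, ?_, ?_, ?_, ?_⟩ <;> simp only [has_coModel, coHolds]
    · simp
    · simp
    · exact fun a b hb hba => ⟨b, hb, hba⟩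
    · exact fun a _ h h' => ⟨h, h'⟩
    · exact fun a b hba hb h => hb (h b hba)
    · exact fun a => hcf.notMem_defeated
    · exact fun a ha h => h (heq.le ha)
    · exact fun a ha h => ha (heq.ge h)

/-- In a model, the atoms over the predicates of `encCo` beyond those determined by the set of
arguments labelled `in` are superfluous. -/
theorem CoRules.inter (h : CoRules M M) (hf : HasFacts Λ M) :
    CoRules M (M ∩ coModel Λ {a | Has M (.lab .inn) [a]} W V R p) := by
  refine ⟨?_, ?_, ?_, ?_, ?_, ?_, ?_, ?_⟩ <;> simp only [has_inter, has_coModel, coHolds]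
  · exact fun a ha h' => ⟨h.inn a ha.1 h', h.inn a ha.1 h'⟩
  · exact fun a ha h' => ⟨h.nin a ha.1 h', h'⟩
  · exact fun a b hb hba => ⟨h.out a b hb.1 hba.1, b, hb.1, hba.2⟩
  · refine fun a ha h' h'' => ⟨h.und a ha.1 h' h'', h', ?_⟩
    rintro ⟨b, hb, hba⟩
    exact h'' (h.out a b hb (hf.2 b a hba))
  · refine fun a b hba hb => ⟨h.undefended a b hba.1 hb, fun hacc => hb ?_⟩
    obtain ⟨c, hc, hcb⟩ := hacc b hba.2
    exact h.out b c hc (hf.2 c b hcb)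
  · exact fun a ha h' => h.conflict a ha.1 h'.1
  · exact fun a ha h' => h.defended a ha.1 h'.1
  · exact fun a ha => h.complete a ha.1

theorem HasFacts.inter_coModel (hf : HasFacts Λ M) : HasFacts Λ (M ∩ coModel Λ E W V R p) :=
  ⟨fun a => ⟨hf.1 a, trivial⟩, fun a b hab => ⟨hf.2 a b hab, hab⟩⟩

theorem represents_coModel (hE : Λ.ConflictFree E) :
    Represents (coModel Λ E W V R p) (Λ.labellingOf E) := by
  intro a l
  change coHolds Λ E W V R p _ _ ↔ _
  cases l
  · simp [coHolds, AF.labellingOf_eq_inn_iff]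
  · simp [coHolds, AF.labellingOf_eq_out_iff hE]
  · simp [coHolds, AF.labellingOf_eq_und_iff]

theorem mem_answerSets_encCo_iff [Nonempty α] :
    M ∈ answerSets (encCo ∪ afFacts Λ) ↔ ∃ E, Λ.Complete E ∧ M = coModel Λ E ∅ ∅ ∅ False := by
  have hsat : ∀ M N, (∀ r ∈ encCo ∪ afFacts Λ, r.Sat M N) ↔ CoRules M N ∧ HasFacts Λ N :=
    fun M N => by rw [forall_mem_union, sat_encCo_iff, sat_afFacts_iff]; rfl
  rw [mem_answerSets_iff]
  simp only [hsat]
  constructor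
  · rintro ⟨⟨h, hf⟩, hmin⟩
    set E : Set α := {a | Has M (.lab .inn) [a]}
    have hsub : M ⊆ coModel Λ E ∅ ∅ ∅ False := fun A hA =>
      (hmin _ Set.inter_subset_left ⟨h.inter hf, hf.inter_coModel⟩ hA).2
    have heq : M = coModel Λ E ∅ ∅ ∅ False :=
      hsub.antisymm (coModel_subset hsub hf h (by simp) (by simp) (by simp) (by simp))
    clear_value E
    subst heq
    exact ⟨E, coRules_coModel_iff.1 h, rfl⟩
  · rintro ⟨E, hE, rfl⟩
    exact ⟨⟨coRules_coModel_iff.2 hE, hasFacts_coModel⟩, fun N _ hs =>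
      coModel_subset subset_rfl hs.2 hs.1 (by simp) (by simp) (by simp) (by simp)⟩

/-! ### Saturation: the preferred and semi-stable encodings -/

theorem forall_noWitAttacks_iff {s : ℕ → α} {y : ℕ} (hy : y ≠ 2) :
    (∀ t : ℕ → α, (∀ n, n ∉ (noWitAttacks y : CondLit α).bound → t n = s n) →
      (noWitAttacks y).guard.inst t ∈ M → (noWitAttacks y).lit.inst t ∈ M) ↔
      ∀ c, Has M .att [c, s y] → Has M .nwit [c] := by
  constructor
  · intro h c hc
    have := h (fun n => if n = 2 then c else s n) (by simp +contextual [noWitAttacks])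
    simp only [noWitAttacks, attA, at1, Atom.inst, Term.inst, List.map_cons, List.map_nil,
      if_true, if_neg hy] at this
    exact this hc
  · intro h t ht hM
    have hty : t y = s y := ht y (by simpa [noWitAttacks] using hy)
    refine h (t 2) ?_
    rw [← hty]
    exact hM

theorem forall_bound_zero_iff {s : ℕ → α} {q q' : Pred} :
    (∀ t : ℕ → α, (∀ n, ¬ n = 0 → t n = s n) →
      (at1 q' 0).inst t ∈ M → (at1 q 0).inst t ∈ M) ↔
      ∀ c, Has M q' [c] → Has M q [c] := by
  constructor
  · intro h c hc
    exact h (fun n => if n = 0 then c else s n) (by simp +contextual) hc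
  · exact fun h t _ hM => h (t 0) hM

/-- The rules of `encWitness`, read in the reduct with respect to `M`. -/
structure WitRules (M N : Set (Atom α)) : Prop where
  guess : ∀ a, Has N .arg [a] → Has N .wit [a] ∨ Has N .nwit [a]
  conflict : ∀ a b, Has N .wit [a] → Has N .wit [b] → Has N .att [a, b] → Has N .spoil []
  undefended : ∀ a b, Has N .wit [a] → Has N .att [b, a] →
    (∀ c, Has M .att [c, b] → Has M .nwit [c]) → (∀ c, Has N .att [c, b] → Has N .nwit [c]) →
    Has N .spoil []
  wit : ∀ a, Has N .spoil [] → Has N .arg [a] → Has N .wit [a]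
  nwit : ∀ a, Has N .spoil [] → Has N .arg [a] → Has N .nwit [a]
  spoil : Has M .spoil []

theorem sat_encWitness_iff [Nonempty α] :
    (∀ r ∈ encWitness, r.Sat M N) ↔ WitRules M N := by
  simp only [encWitness, Set.mem_insert_iff, Set.mem_singleton_iff, forall_eq_or_imp, forall_eq,
    Rule.Sat, List.mem_cons, List.not_mem_nil, or_false, IsEmpty.forall_iff, implies_true,
    forall_const, exists_eq_left, false_and, exists_false, exists_eq_or_imp,
    forall_noWitAttacks_iff (y := 1) (by decide)]
  simp only [at1, attA, spoilA, Atom.inst, Term.inst, List.map_cons, List.map_nil]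
  constructor
  · rintro ⟨h1, h2, h3, h4, h5, h6⟩
    exact ⟨fun a => h1 fun _ => a,
      fun a b h h' h'' => h2 (fun n => if n = 0 then a else b) ⟨h, h', h''⟩,
      fun a b h h' => h3 (fun n => if n = 0 then a else b) ⟨h, h'⟩,
      fun a h h' => h4 (fun _ => a) ⟨h, h'⟩, fun a h h' => h5 (fun _ => a) ⟨h, h'⟩,
      by_contra fun h => h6 (fun _ => Classical.arbitrary α) h⟩
  · rintro ⟨h1, h2, h3, h4, h5, h6⟩
    exact ⟨fun s => h1 (s 0), fun s h => h2 (s 0) (s 1) h.1 h.2.1 h.2.2,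
      fun s h => h3 (s 0) (s 1) h.1 h.2, fun s h => h4 (s 0) h.1 h.2,
      fun s h => h5 (s 0) h.1 h.2, fun s h => h h6⟩

/-- Cutting down to a saturated interpretation preserves the rules of `encWitness`, as it contains
all atoms that these rules derive. -/
theorem WitRules.inter (h : WitRules M M) :
    WitRules M (M ∩ coModel Λ E Set.univ Set.univ R True) := by
  refine ⟨?_, ?_, ?_, ?_, ?_, h.spoil⟩ <;>
    simp only [has_inter, has_coModel, coHolds, Set.mem_univ, and_true]
  · exact fun a ha => h.guess a ha
  · exact fun a b ha hb hab => h.conflict a b ha hb hab.1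
  · exact fun a b ha hba hc _ => h.undefended a b ha hba.1 hc hc
  · exact fun a hs ha => h.wit a hs ha
  · exact fun a hs ha => h.nwit a hs ha

/-- Guessing an admissible set `S` as the witness does not derive `spoil`. -/
theorem WitRules.of_admissible {S : Set α} (hS : Λ.Admissible S) :
    WitRules (coModel Λ E W V R True) (coModel Λ E S Sᶜ R' False) := by
  refine ⟨?_, ?_, ?_, ?_, ?_, trivial⟩ <;>
    simp only [has_coModel, coHolds, Set.mem_compl_iff]
  · exact fun a _ => em _
  · exact fun a b ha hb hab => hS.1.notMem_defeated hb ⟨a, ha, hab⟩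
  · intro a b ha hba _ h
    obtain ⟨c, hc, hcb⟩ := hS.2 ha b hba
    exact h c hcb hc
  · exact fun a h => h.elim
  · exact fun a h => h.elim

/-- A set that is guessed as the witness without deriving `spoil` is admissible. -/
theorem WitRules.admissible (h : WitRules (coModel Λ E W Set.univ R p) N) (hf : HasFacts Λ N)
    (hN : N ⊆ coModel Λ E W' V' R' p') (hs : ¬ Has N .spoil []) :
    Λ.Admissible {a | Has N .wit [a]} := by
  refine ⟨AF.conflictFree_iff.2 ?_, fun a ha b hba => by_contra fun hb => hs ?_⟩
  · rintro a ha ⟨b, hb, hba⟩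
    exact hs (h.conflict b a hb ha (hf.2 b a hba))
  · refine h.undefended a b ha (hf.2 b a hba) (fun c _ => trivial) fun c hc => ?_
    exact (h.guess c (hf.1 c)).resolve_left fun hc' => hb ⟨c, hc', hc.mono hN⟩

/-- Guess and check by saturation. The rules `X` are to derive `spoil` unless the guessed witness
beats the extension `E`. In an answer set all is saturated, `R` being the part of the arguments for
which `nrange` is derived then; and a witness that is admissible and beats `E` would give a smaller
model of the reduct, the one without `spoil`. -/
theorem mem_answerSets_saturated_iff [Nonempty α] {X : Program α} {R : Set α}
    {Beats : Set α → Set α → Prop}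
    (hhead : ∀ r ∈ X, r.head ≠ [] ∧
      ∀ B ∈ r.head, ∀ s E, B.inst s ∈ coModel Λ E Set.univ Set.univ R True)
    (hR : ∀ M N, (∀ r ∈ X, r.Sat M N) → HasFacts Λ N → Has N .spoil [] →
      ∀ a ∈ R, Has N .nrange [a])
    (hbeats : ∀ E S, Λ.Complete E → Λ.Admissible S → Beats S E → ∃ R' ⊆ R,
      ∀ r ∈ X, r.Sat (coModel Λ E Set.univ Set.univ R True) (coModel Λ E S Sᶜ R' False))
    (hspoil : ∀ E S N, coModel Λ E ∅ Sᶜ ∅ False ⊆ N → N ⊆ coModel Λ E S Set.univ R False →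
      (∀ r ∈ X, r.Sat (coModel Λ E Set.univ Set.univ R True) N) → Beats S E) :
    M ∈ answerSets (encCo ∪ encWitness ∪ X ∪ afFacts Λ) ↔
      ∃ E, (Λ.Complete E ∧ ∀ S, Λ.Admissible S → ¬ Beats S E) ∧
        M = coModel Λ E Set.univ Set.univ R True := by
  have hsat : ∀ M N, (∀ r ∈ encCo ∪ encWitness ∪ X ∪ afFacts Λ, r.Sat M N) ↔
      ((CoRules M N ∧ WitRules M N) ∧ ∀ r ∈ X, r.Sat M N) ∧ HasFacts Λ N := fun M N => by
    rw [forall_mem_union, forall_mem_union, forall_mem_union, sat_encCo_iff, sat_encWitness_iff,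
      sat_afFacts_iff]
    rfl
  rw [mem_answerSets_iff]
  simp only [hsat]
  constructor
  · rintro ⟨⟨⟨⟨hco, hwit⟩, hX⟩, hf⟩, hmin⟩
    set E : Set α := {a | Has M (.lab .inn) [a]}
    have hsub : M ⊆ coModel Λ E Set.univ Set.univ R True := fun A hA =>
      (hmin _ Set.inter_subset_left ⟨⟨⟨hco.inter hf, hwit.inter⟩, fun r hr =>
        (hX r hr).inter fun B hB s => (hhead r hr).2 B hB s E⟩, hf.inter_coModel⟩ hA).2
    have heq : M = coModel Λ E Set.univ Set.univ R True :=
      hsub.antisymm (coModel_subset hsub hf hco (fun a _ => hwit.wit a hwit.spoil (hf.1 a))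
        (fun a _ => hwit.nwit a hwit.spoil (hf.1 a)) (hR M M hX hf hwit.spoil)
        fun _ => hwit.spoil)
    clear_value E
    subst heq
    have hE : Λ.Complete E := coRules_coModel_iff.1 hco
    refine ⟨E, ⟨hE, fun S hS hb => ?_⟩, rfl⟩
    obtain ⟨R', hR', hXS⟩ := hbeats E S hE hS hb
    have hle := hmin (coModel Λ E S Sᶜ R' False)
      (coModel_mono (Set.subset_univ _) (Set.subset_univ _) hR' False.elim)
      ⟨⟨⟨coRules_coModel_iff.2 hE, WitRules.of_admissible hS⟩, hXS⟩, hasFacts_coModel⟩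
    exact hwit.spoil.mono hle
  · rintro ⟨E, ⟨hE, hbest⟩, rfl⟩
    refine ⟨⟨⟨⟨coRules_coModel_iff.2 hE, ?_⟩, fun r hr s _ _ _ _ => ?_⟩, hasFacts_coModel⟩, ?_⟩
    · refine ⟨?_, ?_, ?_, ?_, ?_, trivial⟩ <;> simp [coHolds]
    · obtain ⟨B, hB⟩ := List.exists_mem_of_ne_nil _ (hhead r hr).1
      exact ⟨B, hB, (hhead r hr).2 B hB s E⟩
    · rintro N hN ⟨⟨⟨hco, hwit⟩, hX⟩, hf⟩
      have hs : Has N .spoil [] := by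
        by_contra hs
        have hadm := hwit.admissible hf hN hs
        refine hbest _ hadm (hspoil E _ N ?_ ?_ hX)
        · exact coModel_subset subset_rfl hf hco (by simp)
            (fun a ha => (hwit.guess a (hf.1 a)).resolve_left ha) (by simp) (by simp)
        · rintro ⟨q, l⟩ hA
          have hA' : coHolds Λ E Set.univ Set.univ R True q l := hN hA
          change coHolds Λ E _ Set.univ R False q l
          unfold coHolds at hA'
          split at hA' <;> first | exact hA'.elim | exact hA' | exact hA | exact hs hA
      exact coModel_subset subset_rfl hf hco (fun a _ => hwit.wit a hs (hf.1 a))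
        (fun a _ => hwit.nwit a hs (hf.1 a)) (hR _ N hX hf hs) fun _ => hs

theorem mem_answerSets_encPr_iff [Finite α] [Nonempty α] :
    M ∈ answerSets (encPr ∪ afFacts Λ) ↔
      ∃ E, Λ.Preferred E ∧ M = coModel Λ E Set.univ Set.univ ∅ True := by
  have hsat : ∀ M N : Set (Atom α),
      (∀ r ∈ ({ { head := [spoilA], pos := [inA 0, at1 .nwit 0] },
        { head := [spoilA], cond := [⟨[0], at1 .nwit 0, at1 .nin 0⟩] } } : Program α),
        r.Sat M N) ↔
      (∀ a, Has N (.lab .inn) [a] → Has N .nwit [a] → Has N .spoil []) ∧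
      ((∀ a, Has M .nin [a] → Has M .nwit [a]) → (∀ a, Has N .nin [a] → Has N .nwit [a]) →
        Has N .spoil []) := by
    intro M N
    simp only [Set.mem_insert_iff, Set.mem_singleton_iff, forall_eq_or_imp, forall_eq,
      Rule.Sat, List.mem_cons, List.not_mem_nil, or_false, IsEmpty.forall_iff, implies_true,
      forall_const, exists_eq_left, forall_bound_zero_iff]
    refine and_congr ?_ ?_
    · exact ⟨fun h a h' h'' => h (fun _ => a) ⟨h', h''⟩, fun h s h' => h (s 0) h'.1 h'.2⟩
    · exact ⟨fun h => h fun _ => Classical.arbitrary α, fun h _ => h⟩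
  simp only [AF.preferred_iff]
  refine mem_answerSets_saturated_iff (Beats := fun S E => E ⊂ S) ?_ ?_ ?_ ?_
  · simp only [Set.mem_insert_iff, Set.mem_singleton_iff, forall_eq_or_imp, forall_eq]
    simp [spoilA, Atom.inst, coModel, coHolds]
  · simp
  · refine fun E S _ _ hb => ⟨∅, subset_rfl, (hsat _ _).2 ?_⟩
    simp only [has_coModel, coHolds, Set.mem_compl_iff]
    refine ⟨fun a ha ha' => ha' (hb.1 ha), fun _ h => hb.2 fun a ha => ?_⟩
    by_contra ha'
    exact h a ha' ha
  · intro E S N hN hN' hX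
    obtain ⟨h1, h2⟩ := (hsat _ _).1 hX
    have hs : ¬ Has N .spoil [] := fun h => h.mono hN'
    refine ⟨fun a ha => by_contra fun ha' => ?_, fun hle => hs (h2 (fun a _ => trivial) ?_)⟩
    · exact hs (h1 a (Has.mono hN ha) (Has.mono hN ha'))
    · exact fun a ha => Has.mono hN fun ha' => (ha.mono hN' : a ∉ E) (hle ha')

theorem mem_answerSets_encSst_iff [Finite α] [Nonempty α] :
    M ∈ answerSets (encSst ∪ afFacts Λ) ↔
      ∃ E, Λ.SemiStable E ∧ M = coModel Λ E Set.univ Set.univ Set.univ True := by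
  have hsat : ∀ M N : Set (Atom α),
      (∀ r ∈ ({ { head := [at1 .nrange 0], pos := [at1 .nwit 0], cond := [noWitAttacks 0] },
        { head := [at1 .nrange 0], pos := [spoilA, at1 .arg 0] },
        { head := [spoilA], pos := [inA 0, at1 .nrange 0] },
        { head := [spoilA], pos := [outA 0, at1 .nrange 0] },
        { head := [spoilA], cond := [⟨[0], at1 .nrange 0, undA 0⟩] } } : Program α),
        r.Sat M N) ↔
      (∀ a, Has N .nwit [a] → (∀ c, Has M .att [c, a] → Has M .nwit [c]) →
        (∀ c, Has N .att [c, a] → Has N .nwit [c]) → Has N .nrange [a]) ∧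
      (∀ a, Has N .spoil [] → Has N .arg [a] → Has N .nrange [a]) ∧
      (∀ a, Has N (.lab .inn) [a] → Has N .nrange [a] → Has N .spoil []) ∧
      (∀ a, Has N (.lab .out) [a] → Has N .nrange [a] → Has N .spoil []) ∧
      ((∀ a, Has M (.lab .und) [a] → Has M .nrange [a]) →
        (∀ a, Has N (.lab .und) [a] → Has N .nrange [a]) → Has N .spoil []) := by
    intro M N
    simp only [Set.mem_insert_iff, Set.mem_singleton_iff, forall_eq_or_imp, forall_eq,
      Rule.Sat, List.mem_cons, List.not_mem_nil, or_false, IsEmpty.forall_iff, implies_true,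
      forall_const, exists_eq_left, undA, forall_bound_zero_iff,
      forall_noWitAttacks_iff (y := 0) (by decide)]
    refine and_congr ?_ (and_congr ?_ (and_congr ?_ (and_congr ?_ ?_)))
    · exact ⟨fun h a => h fun _ => a, fun h s => h (s 0)⟩
    · exact ⟨fun h a h' h'' => h (fun _ => a) ⟨h', h''⟩, fun h s h' => h (s 0) h'.1 h'.2⟩
    · exact ⟨fun h a h' h'' => h (fun _ => a) ⟨h', h''⟩, fun h s h' => h (s 0) h'.1 h'.2⟩
    · exact ⟨fun h a h' h'' => h (fun _ => a) ⟨h', h''⟩, fun h s h' => h (s 0) h'.1 h'.2⟩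
    · exact ⟨fun h => h fun _ => Classical.arbitrary α, fun h _ => h⟩
  simp only [AF.semiStable_iff]
  refine mem_answerSets_saturated_iff
    (Beats := fun S E => E ∪ Λ.defeated E ⊂ S ∪ Λ.defeated S) ?_ ?_ ?_ ?_
  · simp only [Set.mem_insert_iff, Set.mem_singleton_iff, forall_eq_or_imp, forall_eq]
    simp [spoilA, at1, Atom.inst, Term.inst, coModel, coHolds]
  · exact fun M N hX hf hs a _ => ((hsat M N).1 hX).2.1 a hs (hf.1 a)
  · refine fun E S _ _ hb => ⟨(S ∪ Λ.defeated S)ᶜ, Set.subset_univ _, (hsat _ _).2 ?_⟩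
    simp only [has_coModel, coHolds, Set.mem_compl_iff]
    refine ⟨?_, fun a h => h.elim, fun a ha ha' => ha' (hb.1 (Or.inl ha)),
      fun a ha ha' => ha' (hb.1 (Or.inr ha)), fun _ h => hb.2 fun a ha => ?_⟩
    · rintro a ha - h (ha' | ⟨c, hc, hca⟩)
      exacts [ha ha', h c hca hc]
    · by_contra ha'
      exact h a (not_or.1 ha') ha
  · intro E S N hN hN' hX
    obtain ⟨h1, -, h3, h4, h5⟩ := (hsat _ _).1 hX
    have hs : ¬ Has N .spoil [] := fun h => h.mono hN'
    have hr : ∀ a, a ∉ S ∪ Λ.defeated S → Has N .nrange [a] := fun a ha =>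
      h1 a (Has.mono hN fun h => ha (Or.inl h)) (fun c _ => trivial) fun c hc =>
        Has.mono hN fun h => ha (Or.inr ⟨c, h, hc.mono hN'⟩)
    refine ⟨fun a ha => by_contra fun ha' => hs ?_, fun hle => hs (h5 (fun a _ => trivial) ?_)⟩
    · rcases ha with ha | ha
      · exact h3 a (Has.mono hN ha) (hr a ha')
      · exact h4 a (Has.mono hN ha) (hr a ha')
    · exact fun a ha => hr a fun ha' => (not_or.2 (ha.mono hN' : a ∉ E ∧ a ∉ Λ.defeated E)) (hle ha')

/-! ### All four encodings -/

theorem not_mentions_w_encoding (σ : Semantics) :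
    ∀ r ∈ (encoding σ : Program α), ¬ r.Mentions .w := by
  have hco : ∀ r ∈ (encCo : Program α), ¬ r.Mentions .w := by
    simp only [encCo, Set.mem_insert_iff, Set.mem_singleton_iff, forall_eq_or_imp, forall_eq]
    and_intros <;> simp [Rule.Mentions, inA, outA, undA, attA, at1]
  have hwit : ∀ r ∈ (encWitness : Program α), ¬ r.Mentions .w := by
    simp only [encWitness, Set.mem_insert_iff, Set.mem_singleton_iff, forall_eq_or_imp, forall_eq]
    and_intros <;> simp [Rule.Mentions, attA, at1, spoilA, noWitAttacks]
  cases σ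
  · exact hco
  · simp only [encoding, encSt, Set.mem_insert_iff, Set.mem_singleton_iff, forall_eq_or_imp,
      forall_eq]
    and_intros <;> simp [Rule.Mentions, inA, outA, attA, at1]
  · refine forall_mem_union.2 ⟨forall_mem_union.2 ⟨hco, hwit⟩, ?_⟩
    simp only [Set.mem_insert_iff, Set.mem_singleton_iff, forall_eq_or_imp, forall_eq]
    and_intros <;> simp [Rule.Mentions, inA, at1, spoilA]
  · refine forall_mem_union.2 ⟨forall_mem_union.2 ⟨hco, hwit⟩, ?_⟩
    simp only [Set.mem_insert_iff, Set.mem_singleton_iff, forall_eq_or_imp, forall_eq]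
    and_intros <;> simp [Rule.Mentions, inA, outA, undA, attA, at1, spoilA, noWitAttacks]

theorem isEncoding_encoding [Finite α] [Nonempty α] (σ : Semantics) (Λ : AF α) :
    IsEncoding σ Λ (encoding σ) ∧
      ∀ M ∈ answerSets (encoding σ ∪ afFacts Λ), ∀ N ∈ answerSets (encoding σ ∪ afFacts Λ),
        ∀ L', Represents M L' → Represents N L' → M = N := by
  have hw := not_mentions_w_encoding (α := α) σ
  cases σ
  · exact isEncoding_of_answerSets _ hw (fun _ => mem_answerSets_encCo_iff)
      fun E hE => represents_coModel hE.conflictFree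
  · exact isEncoding_of_answerSets _ hw (fun _ => mem_answerSets_encSt_iff)
      fun E hE => represents_stModel hE
  · exact isEncoding_of_answerSets _ hw (fun _ => mem_answerSets_encPr_iff)
      fun E hE => represents_coModel hE.conflictFree
  · exact isEncoding_of_answerSets _ hw (fun _ => mem_answerSets_encSst_iff)
      fun E hE => represents_coModel hE.conflictFree

end Encodings

end ArgASP

theorem theorem9 {α : Type*} [Finite α] (Λ : AF α) (g : α) (σ : Semantics)
    (L : Labelling α) (hL : L ∈ Λ.labellings σ) (T : TaskType) :
    -- the concrete program is an encoding of `σ`, and each explanation is returned exactly once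
    (IsEncoding σ Λ (encoding σ) ∧
      ∀ L' ∈ explanations T Λ σ g L, ∃! M, M ∈ explain Λ g L T (encoding σ) ∧ Represents M L') ∧
    -- with any encoding of `σ`, the algorithm is sound and complete
    ∀ P : Program α, IsEncoding σ Λ P →
      (∀ M ∈ explain Λ g L T P, ∃ L' ∈ explanations T Λ σ g L, Represents M L') ∧
      (∀ L' ∈ explanations T Λ σ g L, ∃ M ∈ explain Λ g L T P, Represents M L') := by
  have : Nonempty α := ⟨g⟩
  obtain ⟨henc, huniq⟩ := isEncoding_encoding σ Λ
  exact ⟨⟨henc, fun L' hL' => henc.explain_unique huniq hL'⟩,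
    fun P hP => ⟨fun M hM => hP.explain_sound hM, fun L' hL' => hP.explain_complete hL'⟩⟩
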